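/- \textbf{Lemma.} Let $d,m$ be positive integers, $0<h<T$, and let $W$ be a one-dimensional Wiener process on a probability space $(\Omega,\mathbb P)$, adapted to a filtration $\mathcal F=(\mathcal F_t)_{t\ge 0}$. Let $A\in\mathbb R^{d\times d}$ and $B\in\mathbb R^{d\times m}$ be constant matrices, let $\sigma\in L^\infty([0,T],\mathbb R^d)$ be deterministic, and put $\overline B=\Phi_A(t,t+h)B=e^{-hA}B$, where $\Phi_A(t,s)=e^{(t-s)A}$. Let $\mathcal U=L^2_{\mathcal F}([0,T],\mathbb R^m)$ be the space of square-integrable $\mathcal F$-adapted processes. For $U\in\mathcal U$, an associated state is a process $Y\in L^2_{\mathcal F}([0,T],\mathbb R^d)$ such that, for every $t\in[0,T]$, almost surely, $$Y(t)=\int_0^t\bigl(AY(s)+\overline B\,U(s)\bigr)\,ds+\int_0^t\sigma(s)\,dW_s ,$$ that is, $dY=(AY+\overline BU)\,dt+\sigma\,dW$, $Y(0)=0$. Assume that there are matrices $K_n\in\mathbb R^{m\times d}$, $n\ge 1$, such that every $H_n=A-\overline BK_n$ is normal and every complex eigenvalue of $H_n$ has real part at most $-n$. Then: (i) for every $n\ge1$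 there is a control $U_n\in\mathcal U$ with an associated state $Y_n$ such that $U_n(t)=-K_nY_n(t)$ for all $t\in[0,T]$; (ii) for every $n\ge 1$, every such pair $(U_n,Y_n)$, every symmetric positive semidefinite $S\in\mathbb R^{d\times d}$ and every $t\in[0,T]$, the random variable $Y_n(t)^TSY_n(t)$ is integrable and $$\mathbb E\bigl[Y_n(t)^TSY_n(t)\bigr]\le\frac{\|S\|\,\|\sigma\|_\infty^2}{2n},$$ where $\|S\|$ is the operator norm of $S$ for the Euclidean norm and $\|\sigma\|_\infty$ is the essential supremum over $[0,T]$ of the Euclidean norm of $\sigma$; (iii) consequently, for every sequence $(U_n,Y_n)_{n\ge1}$ of such pairs, every symmetric positive semidefinite $S$ and every $t\in[0,T-h]$, $\mathbb E[Y_n(t)^TSY_n(t)]\to0$ as $n\to\infty$. -/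

import Mathlib

open MeasureTheory ProbabilityTheory Filter Set
open scoped NNReal ENNReal Topology Matrix

noncomputable section

/-- The fundamental matrix `Φ_A(t,s)` of `x' = A x` for a time-independent matrix `A`
(see `fundMatrix_self` and `hasDerivAt_fundMatrix` for the defining initial value problem). -/
def fundMatrix {d : ℕ} (A : Matrix (Fin d) (Fin d) ℝ) (t s : ℝ) : Matrix (Fin d) (Fin d) ℝ :=
  NormedSpace.exp ((t - s) • A)

theorem fundMatrix_self {d : ℕ} (A : Matrix (Fin d) (Fin d) ℝ) (s : ℝ) :
    fundMatrix A s s = 1 := by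
  simp [fundMatrix]

open scoped Matrix.Norms.Operator in
theorem hasDerivAt_fundMatrix {d : ℕ} (A : Matrix (Fin d) (Fin d) ℝ) (t s : ℝ) :
    HasDerivAt (fun r => fundMatrix A r s) (A * fundMatrix A t s) t := by
  have h := (hasDerivAt_exp_smul_const' (𝕂 := ℝ) A (t - s)).comp_sub_const t s
  exact h

/-- The input matrix `B̄ = Φ_A(t, t + h) B` of the Artstein-transformed system; it does not depend
on `t` when `A` and `B` are constant, and is written here at `t = 0`. -/
def artsteinInput {d m : ℕ} (A : Matrix (Fin d) (Fin d) ℝ) (B : Matrix (Fin d) (Fin m) ℝ)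
    (h : ℝ) : Matrix (Fin d) (Fin m) ℝ :=
  fundMatrix A 0 h * B

theorem artsteinInput_eq {d m : ℕ} (A : Matrix (Fin d) (Fin d) ℝ) (B : Matrix (Fin d) (Fin m) ℝ)
    (h t : ℝ) : artsteinInput A B h = fundMatrix A t (t + h) * B := by
  simp [artsteinInput, fundMatrix]

/-- A deterministic step function `∑ i < N, c i • 1_{(τ i, τ (i+1)]}` supported in `(0, t]`. -/
structure StepFun (E : Type*) (t : ℝ) where
  /-- number of steps -/
  N : ℕ
  /-- nodes -/
  τ : ℕ → ℝ
  /-- values -/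
  c : ℕ → E
  mono : Monotone τ
  mem : ∀ i, τ i ∈ Icc 0 t

namespace StepFun

/-- The step function as a function of time. -/
def toFun {E : Type*} [AddCommMonoid E] {t : ℝ} (g : StepFun E t) (s : ℝ) : E :=
  ∑ i ∈ Finset.range g.N, (Ioc (g.τ i) (g.τ (i + 1))).indicator (fun _ => g.c i) s

/-- The elementary integral `∑ i < N, (W_{τ (i+1)} - W_{τ i}) c i` against a real process `W`. -/
def integral {Ω E : Type*} [AddCommMonoid E] [Module ℝ E] {t : ℝ} (g : StepFun E t)
    (W : ℝ≥0 → Ω → ℝ) (ω : Ω) : E :=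
  ∑ i ∈ Finset.range g.N,
    (W (g.τ (i + 1)).toNNReal ω - W (g.τ i).toNNReal ω) • g.c i

end StepFun

/-- `I` is (a version of) the Wiener integral `∫₀ᵗ f(s) dW_s` of the deterministic function `f`:
the `L²(P)`-limit of the elementary integrals of step functions converging to `f`
in `L²(0, t)`. -/
def IsWienerIntegral {Ω E : Type*} {mΩ : MeasurableSpace Ω} [NormedAddCommGroup E]
    [NormedSpace ℝ E] (P : Measure Ω) (W : ℝ≥0 → Ω → ℝ) (f : ℝ → E) (t : ℝ) (I : Ω → E) : Prop :=
  MemLp I 2 P ∧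
  ∃ g : ℕ → StepFun E t,
    Tendsto (fun k => eLpNorm (fun s => f s - (g k).toFun s) 2 (volume.restrict (Icc 0 t)))
      atTop (𝓝 0) ∧
    Tendsto (fun k => eLpNorm (fun ω => I ω - (g k).integral W ω) 2 P) atTop (𝓝 0)

/-- The space `L²_F([0,T], E)` of square-integrable processes on `[0,T]` adapted to `F`. -/
structure MemL2Adapted {Ω E : Type*} {mΩ : MeasurableSpace Ω} [NormedAddCommGroup E]
    (P : Measure Ω) (F : Filtration ℝ≥0 mΩ) (T : ℝ) (X : ℝ → Ω → E) : Prop where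
  adapted : ∀ t ∈ Icc 0 T, StronglyMeasurable[F t.toNNReal] (X t)
  memLp : MemLp (Function.uncurry X) 2 ((volume.restrict (Icc 0 T)).prod P)

/-- `Y` solves `dY = (A Y + C U) dt + σ dW`, `Y(0) = 0` on `[0,T]`, in integrated form:
`Y(t) = ∫₀ᵗ (A Y(s) + C U(s)) ds + ∫₀ᵗ σ(s) dW_s` almost surely, for every `t ∈ [0,T]`. -/
structure IsState {Ω : Type*} {mΩ : MeasurableSpace Ω} {d m : ℕ} (P : Measure Ω)
    (F : Filtration ℝ≥0 mΩ) (W : ℝ≥0 → Ω → ℝ) (T : ℝ) (A : Matrix (Fin d) (Fin d) ℝ)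
    (C : Matrix (Fin d) (Fin m) ℝ) (σ : ℝ → EuclideanSpace ℝ (Fin d))
    (U : ℝ → Ω → EuclideanSpace ℝ (Fin m)) (Y : ℝ → Ω → EuclideanSpace ℝ (Fin d)) : Prop where
  mem : MemL2Adapted P F T Y
  eqn : ∀ t ∈ Icc 0 T, IsWienerIntegral P W σ t
    (fun ω => Y t ω - ∫ s in (0 : ℝ)..t,
      (WithLp.toLp 2 (A *ᵥ (Y s ω).ofLp + C *ᵥ (U s ω).ofLp) : EuclideanSpace ℝ (Fin d)))

/-- `U` is an admissible control, `Y` is the associated state of the Artstein-transformed system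
with input delay `h`, and `U` is the linear feedback `U = -K Y` on `[0,T]`. -/
structure IsFeedbackPair {Ω : Type*} {mΩ : MeasurableSpace Ω} {d m : ℕ} (P : Measure Ω)
    (F : Filtration ℝ≥0 mΩ) (W : ℝ≥0 → Ω → ℝ) (T h : ℝ) (A : Matrix (Fin d) (Fin d) ℝ)
    (B : Matrix (Fin d) (Fin m) ℝ) (σ : ℝ → EuclideanSpace ℝ (Fin d))
    (K : Matrix (Fin m) (Fin d) ℝ)
    (U : ℝ → Ω → EuclideanSpace ℝ (Fin m)) (Y : ℝ → Ω → EuclideanSpace ℝ (Fin d)) : Prop where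
  control : MemL2Adapted P F T U
  state : IsState P F W T A (artsteinInput A B h) σ U Y
  feedback : ∀ t ∈ Icc 0 T, ∀ ω, (U t ω).ofLp = -(K *ᵥ (Y t ω).ofLp)

/-- `H` is normal and the real parts of all its complex eigenvalues are at most `c`. -/
def IsNormalWithAbscissaLE {d : ℕ} (H : Matrix (Fin d) (Fin d) ℝ) (c : ℝ) : Prop :=
  H * Hᵀ = Hᵀ * H ∧ ∀ z ∈ spectrum ℂ (H.map (algebraMap ℝ ℂ)), z.re ≤ c

/-- The quadratic form `yᵀ S y`. -/
def quadForm {d : ℕ} (S : Matrix (Fin d) (Fin d) ℝ) (y : EuclideanSpace ℝ (Fin d)) : ℝ :=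
  y.ofLp ⬝ᵥ (S *ᵥ y.ofLp)

/-- The spectral norm of `S` (operator norm for the Euclidean norm). -/
def specNorm {d : ℕ} (S : Matrix (Fin d) (Fin d) ℝ) : ℝ :=
  ‖Matrix.toEuclideanCLM (𝕜 := ℝ) S‖

/-- The essential supremum `‖σ‖_∞` over `[0,T]` of the Euclidean norm of `σ`. -/
def supNorm {d : ℕ} (T : ℝ) (σ : ℝ → EuclideanSpace ℝ (Fin d)) : ℝ :=
  (eLpNorm σ ∞ (volume.restrict (Icc 0 T))).toReal

end

/-! Feedback closes the loop: `Y` solves `dY = H Y dt + σ dW`, `Y(0) = 0`, with `H = A - B̄ K_n`.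
Variation of constants suggests `Y(t) = ∫₀ᵗ e^{(t-s)H} σ(s) dW_s`, hence `E|Y(t)|² = ∫₀ᵗ |e^{(t-s)H}
σ(s)|² ds`. As `H` is normal, `‖e^{τH}‖ ≤ e^{-nτ}` with constant one, whatever the size of `K_n`
(`norm_exp_smul_toEuclideanCLM_le`). The second moment is therefore at most `‖σ‖_∞² ∫₀^∞ e^{-2nτ} dτ
= ‖σ‖_∞² / (2n)`, and `yᵀ S y ≤ ‖S‖ |y|²` concludes.

The isometry is needed for every solution, without path regularity or a stochastic Fubini theorem.
It comes from testing the equation twice (`integral_norm_sq_eq_of_linear_sde`). Multiplying by a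
square-integrable variable `g` and taking expectations gives a deterministic linear equation for
`E[g Y(t)]`, solved uniquely by variation of constants (`integral_smul_eq_mildSolution`). For `g =
⟨v, N(r)⟩`, with `N` the noise integral, the forcing is given by the isometry for Wiener integrals,
and the result is the covariance of `N(r)` and `Y(t)`. For `g = ⟨v, Y(t)⟩` that covariance is the
forcing, and the result is `E[⟨v, Y(t)⟩ Y(t)]`.

Existence (`exists_linear_sde`) is pathwise: `Y = M + V`, where `M` is the Wiener integral process
and `V` the mild solution of `V' = H V + H M`. Adaptedness and joint measurability require a
progressively measurable version of `M`, obtained as a limit of dyadic discretizations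
(`exists_progressive_isWienerIntegral`). -/

noncomputable section

/-! ### Elementary integrals and their isometry -/

namespace StepFun

variable {Ω E : Type*} {mΩ : MeasurableSpace Ω} {P : Measure Ω} {W : ℝ≥0 → Ω → ℝ}
  [NormedAddCommGroup E]

theorem _root_.ProbabilityTheory.IsPreBrownianReal.memLp_two (hW : IsPreBrownianReal W P)
    (t : ℝ≥0) : MemLp (W t) 2 P :=
  (hW.isGaussianProcess.hasGaussianLaw_eval t).memLp_two

theorem _root_.ProbabilityTheory.IsPreBrownianReal.integral_mul [IsProbabilityMeasure P]
    (hW : IsPreBrownianReal W P) (s t : ℝ≥0) : ∫ ω, W s ω * W t ω ∂P = min (s : ℝ) t := by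
  have h := covariance_eq_sub (hW.memLp_two s) (hW.memLp_two t)
  rw [hW.covariance_eval, hW.integral_eval, hW.integral_eval] at h
  simpa using h.symm

/-- Expanding the product leaves four covariances `min`, whose alternating sum is the length of the
overlap. Independence of increments is not needed, and the two intervals may overlap arbitrarily. -/
theorem _root_.ProbabilityTheory.IsPreBrownianReal.integral_increment_mul_increment
    [IsProbabilityMeasure P] (hW : IsPreBrownianReal W P) {a b c d : ℝ} (ha : 0 ≤ a) (hab : a ≤ b)
    (hc : 0 ≤ c) (hcd : c ≤ d) :
    ∫ ω, (W b.toNNReal ω - W a.toNNReal ω) * (W d.toNNReal ω - W c.toNNReal ω) ∂P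
      = volume.real (Ioc a b ∩ Ioc c d) := by
  have hi (s t : ℝ≥0) : Integrable (fun ω => W s ω * W t ω) P :=
    (hW.memLp_two s).integrable_mul (hW.memLp_two t)
  have e : ∀ ω, (W b.toNNReal ω - W a.toNNReal ω) * (W d.toNNReal ω - W c.toNNReal ω)
      = (W b.toNNReal ω * W d.toNNReal ω - W b.toNNReal ω * W c.toNNReal ω)
        - (W a.toNNReal ω * W d.toNNReal ω - W a.toNNReal ω * W c.toNNReal ω) := by
    intro ω; ring
  have hs (s t u v : ℝ≥0) : Integrable (fun ω => W s ω * W t ω - W u ω * W v ω) P :=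
    (hi s t).sub (hi u v)
  simp_rw [e]
  rw [integral_sub (hs _ _ _ _) (hs _ _ _ _), integral_sub (hi _ _) (hi _ _),
    integral_sub (hi _ _) (hi _ _)]
  simp_rw [hW.integral_mul]
  rw [Real.coe_toNNReal a ha, Real.coe_toNNReal b (ha.trans hab), Real.coe_toNNReal c hc,
    Real.coe_toNNReal d (hc.trans hcd), Ioc_inter_Ioc, Real.volume_real_Ioc]
  grind

theorem memLp_integral [NormedSpace ℝ E] (hW : IsPreBrownianReal W P) {t : ℝ} (g : StepFun E t) :
    MemLp (g.integral W) 2 P := by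
  unfold integral
  refine memLp_finsetSum _ fun i _ => ?_
  have h1 : MemLp (W (g.τ (i + 1)).toNNReal - W (g.τ i).toNNReal) 2 P :=
    (hW.memLp_two _).sub (hW.memLp_two _)
  exact (ContinuousLinearMap.toSpanSingleton ℝ (g.c i)).comp_memLp' h1

theorem memLp_indicator_Ioc (a b : ℝ) (c : E) :
    MemLp ((Ioc a b).indicator fun _ => c) 2 (volume : Measure ℝ) :=
  memLp_indicator_const _ measurableSet_Ioc _ (Or.inr (by simp))

theorem memLp_toFun {t : ℝ} (g : StepFun E t) : MemLp g.toFun 2 volume := by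
  unfold toFun
  exact memLp_finsetSum _ fun i _ => memLp_indicator_Ioc _ _ _

/-- Lets step functions with different horizons be compared in `L²` of the whole line. -/
theorem indicator_toFun {t : ℝ} (g : StepFun E t) : (Icc 0 t).indicator g.toFun = g.toFun := by
  ext s
  by_cases hs : s ∈ Icc 0 t
  · simp [hs]
  · rw [indicator_of_notMem hs, toFun, eq_comm]
    refine Finset.sum_eq_zero fun i _ => indicator_of_notMem (fun h => hs ?_) _
    exact ⟨(g.mem i).1.trans h.1.le, h.2.trans (g.mem (i + 1)).2⟩

variable [InnerProductSpace ℝ E]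

theorem _root_.MeasureTheory.MemLp.integrable_inner {α : Type*} {mα : MeasurableSpace α}
    {μ : Measure α} {f g : α → E} (hf : MemLp f 2 μ) (hg : MemLp g 2 μ) :
    Integrable (fun x => inner ℝ (f x) (g x)) μ := by
  refine (L2.integrable_inner (𝕜 := ℝ) (hf.toLp f) (hg.toLp g)).congr ?_
  filter_upwards [hf.coeFn_toLp, hg.coeFn_toLp] with x hx hx'
  rw [hx, hx']

theorem integral_inner_integral [IsProbabilityMeasure P] (hW : IsPreBrownianReal W P) {t t' : ℝ}
    (g : StepFun E t) (g' : StepFun E t') :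
    ∫ ω, inner ℝ (g.integral W ω) (g'.integral W ω) ∂P
      = ∫ s, inner ℝ (g.toFun s) (g'.toFun s) := by
  have hi (s t : ℝ≥0) : MemLp (fun ω => W s ω - W t ω) 2 P :=
    (hW.memLp_two s).sub (hW.memLp_two t)
  have hL : ∀ ω, inner ℝ (g.integral W ω) (g'.integral W ω)
      = ∑ i ∈ Finset.range g.N, ∑ j ∈ Finset.range g'.N,
        ((W (g.τ (i + 1)).toNNReal ω - W (g.τ i).toNNReal ω)
          * (W (g'.τ (j + 1)).toNNReal ω - W (g'.τ j).toNNReal ω))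
          * inner ℝ (g.c i) (g'.c j) := by
    intro ω
    simp only [integral, sum_inner, inner_sum, real_inner_smul_left, real_inner_smul_right]
    rw [Finset.sum_comm]
    refine Finset.sum_congr rfl fun i _ => Finset.sum_congr rfl fun j _ => ?_
    ring
  have hR : ∀ s, inner ℝ (g.toFun s) (g'.toFun s)
      = ∑ i ∈ Finset.range g.N, ∑ j ∈ Finset.range g'.N,
        (Ioc (g.τ i) (g.τ (i + 1)) ∩ Ioc (g'.τ j) (g'.τ (j + 1))).indicator
          (fun _ => inner ℝ (g.c i) (g'.c j)) s := by
    intro s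
    simp only [toFun, sum_inner, inner_sum]
    rw [Finset.sum_comm]
    refine Finset.sum_congr rfl fun i _ => Finset.sum_congr rfl fun j _ => ?_
    by_cases h1 : s ∈ Ioc (g.τ i) (g.τ (i + 1)) <;>
    by_cases h2 : s ∈ Ioc (g'.τ j) (g'.τ (j + 1)) <;> simp [indicator, -mem_Ioc, h1, h2]
  have iL (i j : ℕ) : Integrable (fun ω =>
      ((W (g.τ (i + 1)).toNNReal ω - W (g.τ i).toNNReal ω)
          * (W (g'.τ (j + 1)).toNNReal ω - W (g'.τ j).toNNReal ω))
          * inner ℝ (g.c i) (g'.c j)) P :=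
    ((hi _ _).integrable_mul (hi _ _)).mul_const _
  have iR (i j : ℕ) : Integrable ((Ioc (g.τ i) (g.τ (i + 1)) ∩
      Ioc (g'.τ j) (g'.τ (j + 1))).indicator fun _ => inner ℝ (g.c i) (g'.c j)) volume :=
    (integrable_indicator_iff (measurableSet_Ioc.inter measurableSet_Ioc)).2
        (integrableOn_const ((measure_mono inter_subset_left).trans_lt (by simp)).ne)
  simp_rw [hL, hR]
  rw [integral_finsetSum _ fun i _ => integrable_finsetSum _ fun j _ => iL i j,
    integral_finsetSum _ fun i _ => integrable_finsetSum _ fun j _ => iR i j]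
  refine Finset.sum_congr rfl fun i _ => ?_
  rw [integral_finsetSum _ fun j _ => iL i j, integral_finsetSum _ fun j _ => iR i j]
  refine Finset.sum_congr rfl fun j _ => ?_
  rw [integral_mul_const, hW.integral_increment_mul_increment (g.mem _).1 (g.mono (by simp))
    (g'.mem _).1 (g'.mono (by simp)),
    integral_indicator_const _ (measurableSet_Ioc.inter measurableSet_Ioc), smul_eq_mul]

theorem _root_.MeasureTheory.MemLp.integral_inner_sub_self {α : Type*} {mα : MeasurableSpace α}
    {μ : Measure α} {f g : α → E} (hf : MemLp f 2 μ) (hg : MemLp g 2 μ) :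
    ∫ x, inner ℝ (f x - g x) (f x - g x) ∂μ
      = ∫ x, inner ℝ (f x) (f x) ∂μ - 2 * ∫ x, inner ℝ (f x) (g x) ∂μ
        + ∫ x, inner ℝ (g x) (g x) ∂μ := by
  have h1 : Integrable (fun x => inner ℝ (f x) (f x) - 2 * inner ℝ (f x) (g x)) μ :=
    (hf.integrable_inner hf).sub ((hf.integrable_inner hg).const_mul 2)
  simp_rw [real_inner_sub_sub_self]
  rw [integral_add h1 (hg.integrable_inner hg),
    integral_sub (hf.integrable_inner hf) ((hf.integrable_inner hg).const_mul 2),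
    integral_const_mul]

theorem _root_.MeasureTheory.eLpNorm_two_eq_of_integral_inner {α β : Type*} {mα : MeasurableSpace α}
    {mβ : MeasurableSpace β} {μ : Measure α} {ν : Measure β} {f : α → E} {g : β → E}
    (hf : MemLp f 2 μ) (hg : MemLp g 2 ν)
    (h : ∫ x, inner ℝ (f x) (f x) ∂μ = ∫ x, inner ℝ (g x) (g x) ∂ν) :
    eLpNorm f 2 μ = eLpNorm g 2 ν := by
  rw [hf.eLpNorm_eq_integral_rpow_norm (by simp) (by simp),
    hg.eLpNorm_eq_integral_rpow_norm (by simp) (by simp)]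
  simp_rw [real_inner_self_eq_norm_sq] at h
  simp [h]

/-- Transports the Cauchy property from integrands to integrals. The two partitions differ, so the
isometry for the difference is deduced by expanding squares rather than by refining to a common
partition. -/
theorem eLpNorm_integral_sub_integral [IsProbabilityMeasure P] (hW : IsPreBrownianReal W P)
    {t t' : ℝ} (g : StepFun E t) (g' : StepFun E t') :
    eLpNorm (g.integral W - g'.integral W) 2 P = eLpNorm (g.toFun - g'.toFun) 2 volume := by
  have h1 := g.memLp_integral hW
  have h2 := g'.memLp_integral hW
  have h3 := g.memLp_toFun
  have h4 := g'.memLp_toFun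
  refine eLpNorm_two_eq_of_integral_inner (h1.sub h2) (h3.sub h4) ?_
  simp only [Pi.sub_apply]
  rw [h1.integral_inner_sub_self h2, h3.integral_inner_sub_self h4]
  simp only [integral_inner_integral hW]

end StepFun

/-! ### Limits in `L²` and sampling on uniform partitions -/

theorem MeasureTheory.MemLp.tendsto_integral_inner {α E : Type*} {mα : MeasurableSpace α}
    {μ : Measure α} [NormedAddCommGroup E] [InnerProductSpace ℝ E] {f g : α → E}
    {f' g' : ℕ → α → E} (hf : MemLp f 2 μ) (hg : MemLp g 2 μ) (hf' : ∀ k, MemLp (f' k) 2 μ)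
    (hg' : ∀ k, MemLp (g' k) 2 μ) (hff : Tendsto (fun k => eLpNorm (f - f' k) 2 μ) atTop (𝓝 0))
    (hgg : Tendsto (fun k => eLpNorm (g - g' k) 2 μ) atTop (𝓝 0)) :
    Tendsto (fun k => ∫ x, inner ℝ (f' k x) (g' k x) ∂μ) atTop
      (𝓝 (∫ x, inner ℝ (f x) (g x) ∂μ)) := by
  have key {u v : α → E} (hu : MemLp u 2 μ) (hv : MemLp v 2 μ) :
      ∫ x, inner ℝ (u x) (v x) ∂μ = inner ℝ (hu.toLp u) (hv.toLp v) := by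
    rw [L2.inner_def]
    refine integral_congr_ae ?_
    filter_upwards [hu.coeFn_toLp, hv.coeFn_toLp] with x hx hx'
    rw [hx, hx']
  rw [key hf hg]
  simp_rw [fun k => key (hf' k) (hg' k)]
  refine Tendsto.inner ?_ ?_
  · refine (Lp.tendsto_Lp_iff_tendsto_eLpNorm'' _ hf' _ hf).2 ?_
    simpa only [eLpNorm_sub_comm _ f] using hff
  · refine (Lp.tendsto_Lp_iff_tendsto_eLpNorm'' _ hg' _ hg).2 ?_
    simpa only [eLpNorm_sub_comm _ g] using hgg

/-- The left-endpoint step function of `φ` on the uniform partition of `[0, t]` in `n` pieces. -/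
def StepFun.uniform {E : Type*} {t : ℝ} (ht : 0 ≤ t) (φ : ℝ → E) (n : ℕ) : StepFun E t where
  N := n
  -- Nodes are indexed by all of `ℕ`; the cap at `t` keeps those beyond index `n` in `[0, t]`.
  τ i := min (i * (t / n)) t
  c i := φ (min (i * (t / n)) t)
  mono i j hij := by
    have : (i : ℝ) ≤ j := by exact_mod_cast hij
    dsimp only
    gcongr
  mem i := ⟨le_min (by positivity) ht, min_le_right _ _⟩

theorem StepFun.uniform_apply {E : Type*} [AddCommMonoid E] {t : ℝ} (ht : 0 ≤ t)
    (φ : ℝ → E) {n : ℕ} (hn : n ≠ 0) {s : ℝ} (hs : s ∈ Ioc 0 t) :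
    ∃ r ∈ Icc 0 t, |s - r| ≤ t / n ∧ (StepFun.uniform ht φ n).toFun s = φ r := by
  set g := StepFun.uniform ht φ n with hg
  have hτn : g.τ n = t := by
    have : (n : ℝ) ≠ 0 := by exact_mod_cast hn
    simp only [hg, uniform]
    rw [mul_div_cancel₀ _ this, min_self]
  have hτ0 : g.τ 0 = 0 := by simp [hg, uniform, ht]
  have hex : ∃ i, s ≤ g.τ (i + 1) := ⟨n - 1, by
    rw [Nat.sub_add_cancel (Nat.one_le_iff_ne_zero.2 hn), hτn]; exact hs.2⟩
  classical
  -- The first cell whose right endpoint reaches `s`; minimality puts its left endpoint strictly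
  -- below `s`.
  set i := Nat.find hex with hi
  have h1 : s ≤ g.τ (i + 1) := Nat.find_spec hex
  have h2 : g.τ i < s := by
    rcases Nat.eq_zero_or_pos i with h0 | h0
    · rw [h0, hτ0]; exact hs.1
    · have := Nat.find_min hex (m := i - 1) (by omega)
      rw [Nat.sub_add_cancel h0] at this
      exact not_le.1 this
  have hin : i < n := by
    by_contra! h
    have := g.mono h
    rw [hτn] at this
    linarith [hs.2]
  refine ⟨g.τ i, g.mem i, ?_, ?_⟩
  · rw [abs_of_pos (sub_pos.2 h2)]
    have h3 : g.τ (i + 1) ≤ (i + 1 : ℕ) * (t / n) := min_le_left _ _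
    have h4 : g.τ i = i * (t / n) := by
      rcases min_choice (i * (t / n)) t with h | h
      · exact h
      · have : g.τ i = t := h
        linarith [hs.2]
    push_cast at h3
    linarith
  · unfold toFun
    rw [Finset.sum_eq_single_of_mem i (show i ∈ Finset.range g.N from Finset.mem_range.2 hin)]
    · rw [indicator_of_mem (show s ∈ Ioc (g.τ i) (g.τ (i + 1)) from ⟨h2, h1⟩)]; rfl
    · intro j _ hj
      refine indicator_of_notMem (fun h => hj ?_) _
      rcases lt_trichotomy j i with hlt | heq | hgt
      · have := g.mono (show j + 1 ≤ i by omega)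
        linarith [h.2]
      · exact heq
      · have := g.mono (show i + 1 ≤ j by omega)
        linarith [h.1]

/-- Composition of a step function with a linear map. -/
def StepFun.map {E E' : Type*} {t : ℝ} (L : E → E') (g : StepFun E t) : StepFun E' t :=
  { g with c := fun i => L (g.c i) }

/-! ### The Wiener integral: isometry and existence -/

section

variable {Ω E E' : Type*} {mΩ : MeasurableSpace Ω} {P : Measure Ω} {W : ℝ≥0 → Ω → ℝ}
  [NormedAddCommGroup E] [InnerProductSpace ℝ E] [NormedAddCommGroup E'] [InnerProductSpace ℝ E']

theorem StepFun.toFun_map {t : ℝ} (L : E →L[ℝ] E') (g : StepFun E t) (s : ℝ) :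
    (g.map L).toFun s = L (g.toFun s) := by
  simp only [toFun, map, map_sum]
  refine Finset.sum_congr rfl fun i _ => ?_
  by_cases hs : s ∈ Ioc (g.τ i) (g.τ (i + 1)) <;> simp only [indicator, hs, if_true, if_false,
    map_zero]

theorem StepFun.integral_map {t : ℝ} (L : E →L[ℝ] E') (g : StepFun E t) (ω : Ω) :
    (g.map L).integral W ω = L (g.integral W ω) := by
  simp [integral, map, map_sum]

theorem eLpNorm_clm_comp_tendsto_zero {α : Type*} {mα : MeasurableSpace α} {μ : Measure α}
    (L : E →L[ℝ] E') {u : ℕ → α → E} (hu : Tendsto (fun k => eLpNorm (u k) 2 μ) atTop (𝓝 0)) :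
    Tendsto (fun k => eLpNorm (fun x => L (u k x)) 2 μ) atTop (𝓝 0) := by
  refine tendsto_of_tendsto_of_tendsto_of_le_of_le tendsto_const_nhds
    (h := fun k => ENNReal.ofReal ‖L‖ * eLpNorm (u k) 2 μ) ?_ (fun _ => zero_le)
    fun k => eLpNorm_le_mul_eLpNorm_of_ae_le_mul (ae_of_all _ fun x => L.le_opNorm _) 2
  simpa using ENNReal.Tendsto.const_mul hu (a := ENNReal.ofReal ‖L‖) (Or.inr ENNReal.ofReal_ne_top)

theorem IsWienerIntegral.map {f : ℝ → E} {t : ℝ} {I : Ω → E} (h : IsWienerIntegral P W f t I)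
    (L : E →L[ℝ] E') : IsWienerIntegral P W (fun s => L (f s)) t (fun ω => L (I ω)) := by
  obtain ⟨h1, g, h2, h3⟩ := h
  refine ⟨L.comp_memLp' h1, fun k => (g k).map L, ?_, ?_⟩
  · simpa only [StepFun.toFun_map, ← map_sub] using eLpNorm_clm_comp_tendsto_zero L h2
  · simpa only [StepFun.integral_map, ← map_sub] using eLpNorm_clm_comp_tendsto_zero L h3

theorem IsWienerIntegral.congr {f : ℝ → E} {t : ℝ} {I J : Ω → E}
    (h : IsWienerIntegral P W f t I) (hIJ : I =ᵐ[P] J) : IsWienerIntegral P W f t J := by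
  obtain ⟨h1, g, h2, h3⟩ := h
  refine ⟨h1.ae_eq hIJ, g, h2, ?_⟩
  convert h3 using 2 with k
  refine eLpNorm_congr_ae ?_
  filter_upwards [hIJ] with ω hω
  rw [hω]

/-- The Itô isometry for Wiener integrals, in polarized form. -/
theorem IsWienerIntegral.integral_inner [IsProbabilityMeasure P] (hW : IsPreBrownianReal W P)
    {f f' : ℝ → E} {t t' : ℝ} {I I' : Ω → E} (h : IsWienerIntegral P W f t I)
    (h' : IsWienerIntegral P W f' t' I') (hf : MemLp f 2 (volume.restrict (Icc 0 t)))
    (hf' : MemLp f' 2 (volume.restrict (Icc 0 t'))) :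
    ∫ ω, inner ℝ (I ω) (I' ω) ∂P
      = ∫ s, inner ℝ ((Icc 0 t).indicator f s) ((Icc 0 t').indicator f' s) := by
  obtain ⟨h1, g, h2, h3⟩ := h
  obtain ⟨h1', g', h2', h3'⟩ := h'
  -- Extension by zero places integrands with different horizons in one space `L²(ℝ)`, where the
  -- elementary isometry passes to the limit.
  have key {t : ℝ} {f : ℝ → E} (g : StepFun E t) :
      eLpNorm (fun s => f s - g.toFun s) 2 (volume.restrict (Icc 0 t))
        = eLpNorm ((Icc 0 t).indicator f - g.toFun) 2 volume := by
    rw [← eLpNorm_indicator_eq_eLpNorm_restrict measurableSet_Icc]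
    congr 1
    conv_rhs => rw [← g.indicator_toFun, ← indicator_sub']
    rfl
  simp_rw [key] at h2 h2'
  refine tendsto_nhds_unique (MemLp.tendsto_integral_inner h1 h1'
    (fun k => (g k).memLp_integral hW) (fun k => (g' k).memLp_integral hW) h3 h3') ?_
  simp_rw [StepFun.integral_inner_integral hW]
  exact MemLp.tendsto_integral_inner ((memLp_indicator_iff_restrict measurableSet_Icc).2 hf)
    ((memLp_indicator_iff_restrict measurableSet_Icc).2 hf') (fun k => (g k).memLp_toFun)
    (fun k => (g' k).memLp_toFun) h2 h2'

/-- Half of `ε` pays for replacing `f` by a bounded continuous `φ`, the other half for sampling `φ`,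
which is uniformly continuous on `[0, t]`, on a fine uniform partition. -/
theorem StepFun.exists_eLpNorm_sub_le {t : ℝ} (ht : 0 ≤ t) {f : ℝ → E}
    (hf : MemLp f 2 (volume.restrict (Icc 0 t))) {ε : ℝ≥0∞} (hε : ε ≠ 0) :
    ∃ g : StepFun E t, eLpNorm (fun s => f s - g.toFun s) 2 (volume.restrict (Icc 0 t)) ≤ ε := by
  set μ : Measure ℝ := volume.restrict (Icc 0 t)
  obtain ⟨φ, hφ, hφm⟩ := hf.exists_boundedContinuous_eLpNorm_sub_le (by simp)
    (ENNReal.half_pos hε).ne'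
  obtain ⟨η, hη, hηε⟩ : ∃ η : ℝ, 0 < η ∧
      μ univ ^ (2 : ℝ≥0∞).toReal⁻¹ * ENNReal.ofReal η ≤ ε / 2 := by
    have hfin : μ univ ^ (2 : ℝ≥0∞).toReal⁻¹ ≠ ∞ :=
      (ENNReal.rpow_lt_top_of_nonneg (by simp) (measure_ne_top _ _)).ne
    have h0 : Tendsto (fun η : ℝ => μ univ ^ (2 : ℝ≥0∞).toReal⁻¹ * ENNReal.ofReal η) (𝓝[>] 0)
        (𝓝 0) := by
      have := ENNReal.Tendsto.const_mul (a := μ univ ^ (2 : ℝ≥0∞).toReal⁻¹)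
        ((ENNReal.continuous_ofReal.tendsto 0).mono_left (nhdsWithin_le_nhds (s := Ioi 0)))
        (Or.inr hfin)
      simpa using this
    obtain ⟨η, h1, h2⟩ := ((h0.eventually (ge_mem_nhds (ENNReal.half_pos hε))).and
      self_mem_nhdsWithin).exists
    exact ⟨η, h2, h1⟩
  obtain ⟨δ, hδ, hδη⟩ := Metric.uniformContinuousOn_iff.1
    (isCompact_Icc.uniformContinuousOn_of_continuous (s := Icc 0 t) φ.continuous.continuousOn) η hη
  obtain ⟨n, hn⟩ := exists_nat_gt (t / δ)
  have hn0 : n ≠ 0 := by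
    rintro rfl
    have : 0 ≤ t / δ := by positivity
    simp only [Nat.cast_zero] at hn
    linarith
  refine ⟨StepFun.uniform ht φ n, ?_⟩
  set g := StepFun.uniform ht φ n
  have hgm : MemLp g.toFun 2 μ := g.memLp_toFun.restrict _
  have hsplit : (fun s => f s - g.toFun s) = (f - φ) + (φ - g.toFun) := by
    ext s; simp
  rw [hsplit]
  refine (eLpNorm_add_le (hf.sub hφm).1 (hφm.sub hgm).1 (by simp)).trans ?_
  rw [← ENNReal.add_halves ε]
  refine add_le_add hφ (le_trans ?_ hηε)
  refine eLpNorm_le_of_ae_bound ?_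
  -- The cells are left-open, so the point `0` is not covered and is discarded as a null set.
  have h0 : ∀ᵐ s ∂μ, s ≠ 0 := ae_restrict_of_ae (by simp [ae_iff, measure_singleton])
  filter_upwards [h0, ae_restrict_mem measurableSet_Icc] with s hs0 hs
  have hs' : s ∈ Ioc 0 t := ⟨lt_of_le_of_ne hs.1 (Ne.symm hs0), hs.2⟩
  obtain ⟨r, hr, hrs, hgr⟩ := StepFun.uniform_apply ht φ hn0 hs'
  rw [Pi.sub_apply, hgr, ← dist_eq_norm]
  refine (hδη s hs r hr ?_).le
  rw [Real.dist_eq]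
  refine hrs.trans_lt ?_
  have : (0 : ℝ) < n := by positivity
  rw [div_lt_iff₀ hδ] at hn
  rw [div_lt_iff₀ this]
  linarith

theorem StepFun.stronglyMeasurable_integral {F : Filtration ℝ≥0 mΩ} (hWF : StronglyAdapted F W)
    {t : ℝ} (g : StepFun E t) : StronglyMeasurable[F t.toNNReal] (g.integral W) := by
  unfold integral
  refine Finset.stronglyMeasurable_fun_sum _ fun i _ => ?_
  have h (i : ℕ) : StronglyMeasurable[F t.toNNReal] (W (g.τ i).toNNReal) :=
    (hWF _).mono (F.mono (Real.toNNReal_le_toNNReal (g.mem i).2))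
  exact ((h _).sub (h _)).smul_const _

/-- By the isometry, integrals of approximating step functions are Cauchy. The limit is taken in
`L²` of the trimmed measure, so a representative is truly `F t`-measurable although the filtration
need not be complete. -/
theorem exists_isWienerIntegral [IsProbabilityMeasure P] [CompleteSpace E]
    (hW : IsPreBrownianReal W P)
    {F : Filtration ℝ≥0 mΩ} (hWF : StronglyAdapted F W) {t : ℝ} (ht : 0 ≤ t) {f : ℝ → E}
    (hf : MemLp f 2 (volume.restrict (Icc 0 t))) :
    ∃ I, StronglyMeasurable[F t.toNNReal] I ∧ IsWienerIntegral P W f t I := by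
  -- Two errors `2^{-(N+2)}` add up to `2^{-(N+1)}`, strictly below the summable bound `2^{-N}` used
  -- for completeness.
  choose g hg using fun k : ℕ => StepFun.exists_eLpNorm_sub_le ht hf (ε := 2⁻¹ ^ (k + 2))
    (pow_ne_zero _ (by simp))
  have hm := F.le t.toNNReal
  have hsm (k : ℕ) := (g k).stronglyMeasurable_integral hWF
  have hLp (k : ℕ) : MemLp ((g k).integral W) 2 (P.trim hm) :=
    ⟨(hsm k).aestronglyMeasurable, by
      rw [eLpNorm_trim hm (hsm k)]; exact ((g k).memLp_integral hW).2⟩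
  have hdist (n m : ℕ) : eLpNorm ((g n).toFun - (g m).toFun) 2 volume
      ≤ 2⁻¹ ^ (n + 2) + 2⁻¹ ^ (m + 2) := by
    rw [← (g n).indicator_toFun, ← (g m).indicator_toFun, ← indicator_sub',
      eLpNorm_indicator_eq_eLpNorm_restrict measurableSet_Icc]
    have : (g n).toFun - (g m).toFun
        = (fun s => f s - (g m).toFun s) - (fun s => f s - (g n).toFun s) := by
      ext s; simp
    rw [this, add_comm]
    exact (eLpNorm_sub_le (hf.sub ((g m).memLp_toFun.restrict _)).1
      (hf.sub ((g n).memLp_toFun.restrict _)).1 (by simp)).trans (add_le_add (hg m) (hg n))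
  have hcau (N n m : ℕ) (hn : N ≤ n) (hm' : N ≤ m) :
      eLpNorm ((g n).integral W - (g m).integral W) 2 (P.trim hm) < 2⁻¹ ^ N := by
    rw [eLpNorm_trim hm ((hsm n).sub (hsm m)), StepFun.eLpNorm_integral_sub_integral hW]
    refine (hdist n m).trans_lt ?_
    have hp (k : ℕ) (hk : N ≤ k) : (2⁻¹ : ℝ≥0∞) ^ (k + 2) ≤ 2⁻¹ ^ (N + 2) :=
      pow_le_pow_of_le_one zero_le (by simp) (by omega)
    refine (add_le_add (hp n hn) (hp m hm')).trans_lt ?_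
    have e : (2⁻¹ : ℝ≥0∞) ^ (N + 2) + 2⁻¹ ^ (N + 2) = 2⁻¹ ^ N / 2 := by
      rw [pow_succ, pow_succ, ← mul_add, ENNReal.inv_two_add_inv_two, mul_one]
      rfl
    rw [e]
    exact ENNReal.half_lt_self (pow_ne_zero _ (by simp)) (ENNReal.pow_ne_top (by simp))
  obtain ⟨J, hJ, hlim⟩ := Lp.cauchy_complete_eLpNorm (by simp) hLp
    (B := fun N => 2⁻¹ ^ N) (by rw [ENNReal.tsum_geometric]; simp) hcau
  obtain ⟨I, hI, hJI⟩ := hJ.1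
  refine ⟨I, hI, memLp_of_memLp_trim hm (hJ.ae_eq hJI), g, ?_, ?_⟩
  · refine tendsto_of_tendsto_of_tendsto_of_le_of_le tendsto_const_nhds
      (h := fun k => 2⁻¹ ^ (k + 2)) ?_ (fun _ => zero_le) hg
    exact (ENNReal.tendsto_pow_atTop_nhds_zero_of_lt_one (by simp)).comp (tendsto_add_atTop_nat 2)
  · convert hlim using 2 with k
    rw [eLpNorm_congr_ae (ae_eq_rfl.sub hJI), eLpNorm_trim hm ((hsm k).sub hI), eLpNorm_sub_comm]
    rfl

end

/-! ### Deterministic linear equations and variation of constants -/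

section

variable {E : Type*} [NormedAddCommGroup E] [NormedSpace ℝ E]

theorem intervalIntegrable_clm_apply {k : ℝ → E →L[ℝ] E} (hk : Continuous k) {g : ℝ → E} {a b : ℝ}
    (hg : IntervalIntegrable g volume a b) :
    IntervalIntegrable (fun s => k s (g s)) volume a b := by
  obtain ⟨C, hC⟩ := (isCompact_uIcc (a := a) (b := b)).exists_bound_of_continuousOn hk.continuousOn
  rw [intervalIntegrable_iff] at hg ⊢
  refine (hg.norm.const_mul C).mono' ?_ ?_
  · exact (isBoundedBilinearMap_apply (𝕜 := ℝ) (E := E) (F := E)).continuous.comp_aestronglyMeasurable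
      (hk.aestronglyMeasurable.prodMk hg.1)
  · filter_upwards [ae_restrict_mem measurableSet_uIoc] with s hs
    exact (ContinuousLinearMap.le_opNorm _ _).trans
      (mul_le_mul_of_nonneg_right (hC s (uIoc_subset_uIcc hs)) (norm_nonneg _))

variable [CompleteSpace E]

/-- Fubini on the triangle `0 < r ≤ s ≤ t`. -/
theorem integral_clm_apply_primitive {k : ℝ → E →L[ℝ] E} (hk : Continuous k) {g : ℝ → E} {t : ℝ}
    (ht : 0 ≤ t) (hg : IntervalIntegrable g volume 0 t) :
    ∫ s in (0 : ℝ)..t, k s (∫ r in (0 : ℝ)..s, g r)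
      = ∫ r in (0 : ℝ)..t, (∫ s in r..t, k s) (g r) := by
  set μ : Measure ℝ := volume.restrict (Ioc 0 t)
  set D : Set (ℝ × ℝ) := {p | p.2 ≤ p.1}
  have hD : MeasurableSet D := measurableSet_le measurable_snd measurable_fst
  set φ : ℝ → ℝ → E := fun s r => D.indicator (fun p => k p.1 (g p.2)) (s, r)
  have hgi : Integrable g μ := (intervalIntegrable_iff_integrableOn_Ioc_of_le ht).1 hg
  have hki : Integrable k μ :=
    (hk.integrableOn_Icc).mono_set Ioc_subset_Icc_self
  have hφ : Integrable (Function.uncurry φ) (μ.prod μ) :=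
    (hki.op_fst_snd (op := fun (A : E →L[ℝ] E) x => A x) (by fun_prop)
      ⟨1, fun A x => by simpa using A.le_opNorm x⟩ hgi).indicator hD
  have h1 : ∫ s in (0 : ℝ)..t, k s (∫ r in (0 : ℝ)..s, g r) = ∫ s, ∫ r, φ s r ∂μ ∂μ := by
    rw [intervalIntegral.integral_of_le ht]
    refine setIntegral_congr_fun measurableSet_Ioc fun s hs => ?_
    have : ∀ r, φ s r = (Iic s).indicator (fun r => k s (g r)) r := fun r => rfl
    simp_rw [this]
    rw [integral_indicator measurableSet_Iic, Measure.restrict_restrict measurableSet_Iic,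
      inter_comm, Ioc_inter_Iic, min_eq_right hs.2, intervalIntegral.integral_of_le hs.1.le,
      ContinuousLinearMap.integral_comp_comm]
    exact hgi.mono_measure (Measure.restrict_mono (Ioc_subset_Ioc_right hs.2) le_rfl)
  have h2 : ∫ r in (0 : ℝ)..t, (∫ s in r..t, k s) (g r) = ∫ r, ∫ s, φ s r ∂μ ∂μ := by
    rw [intervalIntegral.integral_of_le ht]
    refine setIntegral_congr_fun measurableSet_Ioc fun r hr => ?_
    have : ∀ s, φ s r = (Ici r).indicator (fun s => k s (g r)) s := fun s => rfl
    simp_rw [this]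
    rw [integral_indicator measurableSet_Ici, Measure.restrict_restrict measurableSet_Ici,
      intervalIntegral.integral_of_le hr.2, ContinuousLinearMap.integral_apply]
    · have : Ici r ∩ Ioc 0 t = Icc r t := by
        ext s; simp only [mem_inter_iff, mem_Ici, mem_Ioc, mem_Icc]
        exact ⟨fun h => ⟨h.1, h.2.2⟩, fun h => ⟨h.1, hr.1.trans_le h.1, h.2⟩⟩
      rw [this, integral_Icc_eq_integral_Ioc]
    · exact (hk.integrableOn_Icc).mono_set Ioc_subset_Icc_self
  rw [h1, h2, integral_integral_swap hφ]

theorem continuous_exp_smul (L : E →L[ℝ] E) :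
    Continuous fun s : ℝ => (NormedSpace.exp (s • L) : E →L[ℝ] E) :=
  continuous_iff_continuousAt.2 fun s => (hasDerivAt_exp_smul_const (𝕂 := ℝ) L s).continuousAt

theorem exp_add_smul_apply (L : E →L[ℝ] E) (s t : ℝ) (x : E) :
    NormedSpace.exp ((s + t) • L) x = NormedSpace.exp (s • L) (NormedSpace.exp (t • L) x) := by
  let +nondep : NormedAlgebra ℚ (E →L[ℝ] E) := .restrictScalars ℚ ℝ _
  rw [add_smul, NormedSpace.exp_add_of_commute (((Commute.refl L).smul_left s).smul_right t)]
  rfl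

/-- The solution `∫₀ᵗ exp ((t - s) L) f(s) ds` of `x' = L x + f`, `x 0 = 0`. -/
def mildSolution (L : E →L[ℝ] E) (f : ℝ → E) (t : ℝ) : E :=
  ∫ s in (0 : ℝ)..t, NormedSpace.exp ((t - s) • L) (f s)

theorem mildSolution_eq (L : E →L[ℝ] E) {f : ℝ → E} {t : ℝ}
    (hf : IntervalIntegrable f volume 0 t) :
    mildSolution L f t
      = NormedSpace.exp (t • L) (∫ s in (0 : ℝ)..t, NormedSpace.exp ((-s) • L) (f s)) := by
  have hi : IntervalIntegrable (fun s => NormedSpace.exp ((-s) • L) (f s)) volume 0 t :=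
    intervalIntegrable_clm_apply ((continuous_exp_smul L).comp continuous_neg) hf
  rw [← ContinuousLinearMap.intervalIntegral_comp_comm _ hi]
  simp_rw [← exp_add_smul_apply, ← sub_eq_add_neg]
  rfl

theorem continuousOn_mildSolution (L : E →L[ℝ] E) {f : ℝ → E} {T : ℝ} (hT : 0 ≤ T)
    (hf : IntervalIntegrable f volume 0 T) : ContinuousOn (mildSolution L f) (Icc 0 T) := by
  have hi := intervalIntegrable_clm_apply ((continuous_exp_smul L).comp continuous_neg) hf
  have h1 := intervalIntegral.continuousOn_primitive_interval' hi left_mem_uIcc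
  rw [uIcc_of_le hT] at h1
  refine ((continuous_exp_smul L).continuousOn.clm_apply h1).congr fun t ht => ?_
  exact mildSolution_eq L (hf.mono_set (by
    rw [uIcc_of_le hT, uIcc_of_le ht.1]; exact Icc_subset_Icc_right ht.2))

/-- The forcing is only integrable, so instead of differentiating, the order of integration is
exchanged; the inner integral is explicit because `L e^{sL}` has primitive `e^{sL}`. -/
theorem mildSolution_eq_integral (L : E →L[ℝ] E) {f : ℝ → E} {t : ℝ} (ht : 0 ≤ t)
    (hf : IntervalIntegrable f volume 0 t) :
    mildSolution L f t = ∫ s in (0 : ℝ)..t, (L (mildSolution L f s) + f s) := by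
  set g : ℝ → E := fun s => NormedSpace.exp ((-s) • L) (f s)
  set k : ℝ → E →L[ℝ] E := fun s => L * NormedSpace.exp (s • L)
  have hk : Continuous k := continuous_const.mul (continuous_exp_smul L)
  have hg : IntervalIntegrable g volume 0 t :=
    intervalIntegrable_clm_apply ((continuous_exp_smul L).comp continuous_neg) hf
  have hsub {s : ℝ} (hs : s ∈ Icc 0 t) : IntervalIntegrable f volume 0 s :=
    hf.mono_set (by rw [uIcc_of_le ht, uIcc_of_le hs.1]; exact Icc_subset_Icc_right hs.2)
  have hL : IntervalIntegrable (fun s => L (mildSolution L f s)) volume 0 t := by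
    refine ContinuousOn.intervalIntegrable ?_
    rw [uIcc_of_le ht]
    exact L.continuous.comp_continuousOn (continuousOn_mildSolution L ht hf)
  have e1 : ∫ s in (0 : ℝ)..t, L (mildSolution L f s)
      = ∫ s in (0 : ℝ)..t, k s (∫ r in (0 : ℝ)..s, g r) := by
    refine intervalIntegral.integral_congr fun s hs => ?_
    rw [uIcc_of_le ht] at hs
    simp only [mildSolution_eq L (hsub hs)]
    rfl
  have e2 (r : ℝ) : ∫ s in r..t, k s = NormedSpace.exp (t • L) - NormedSpace.exp (r • L) :=
    intervalIntegral.integral_eq_sub_of_hasDerivAt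
      (fun s _ => hasDerivAt_exp_smul_const' (𝕂 := ℝ) L s) (hk.intervalIntegrable _ _)
  have e3 (r : ℝ) : NormedSpace.exp (r • L) (g r) = f r := by
    simp only [g]
    rw [← exp_add_smul_apply]; simp
  rw [intervalIntegral.integral_add hL hf, e1, integral_clm_apply_primitive hk ht hg]
  simp_rw [e2, _root_.sub_apply, e3]
  rw [intervalIntegral.integral_sub
    (intervalIntegrable_clm_apply (k := fun _ => NormedSpace.exp (t • L)) continuous_const hg) hf,
    sub_add_cancel, ContinuousLinearMap.intervalIntegral_comp_comm _ hg, mildSolution_eq L hf]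

theorem eq_zero_of_eq_integral_clm (L : E →L[ℝ] E) {e : ℝ → E} {T : ℝ}
    (hT : 0 ≤ T) (he : ContinuousOn e (Icc 0 T))
    (h : ∀ t ∈ Icc 0 T, e t = ∫ s in (0 : ℝ)..t, L (e s)) : ∀ t ∈ Icc 0 T, e t = 0 := by
  -- Constant extension makes the primitive `G` differentiable everywhere, so Grönwall's inequality
  -- applies to `G`, which equals `e` on `[0, T]`.
  set e' : ℝ → E := IccExtend hT ((Icc 0 T).domRestrict e) with he'
  have hee {t : ℝ} (ht : t ∈ Icc 0 T) : e' t = e t := by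
    rw [he', IccExtend_of_mem _ _ ht]; rfl
  have hc : Continuous e' := (continuousOn_iff_continuous_domRestrict.1 he).Icc_extend'
  set G : ℝ → E := fun t => ∫ s in (0 : ℝ)..t, L (e' s)
  have hG (t : ℝ) : HasDerivAt G (L (e' t)) t :=
    (L.continuous.comp hc).integral_hasStrictDerivAt 0 t |>.hasDerivAt
  have hGe {t : ℝ} (ht : t ∈ Icc 0 T) : G t = e t := by
    rw [h t ht]
    refine intervalIntegral.integral_congr fun s hs => ?_
    rw [uIcc_of_le ht.1] at hs
    rw [hee ⟨hs.1, hs.2.trans ht.2⟩]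
  intro t ht
  have := norm_le_gronwallBound_of_norm_deriv_right_le (f := G) (f' := fun t => L (e' t))
    (δ := 0) (K := ‖L‖) (ε := 0) (a := 0) (b := T)
    (fun t _ => (hG t).continuousAt.continuousWithinAt) (fun t _ => (hG t).hasDerivWithinAt)
    (by simp [G]) (fun t ht => by
      rw [hGe ⟨ht.1, ht.2.le⟩, hee ⟨ht.1, ht.2.le⟩, add_zero]; exact L.le_opNorm _) t ht
  rw [gronwallBound_ε0_δ0, hGe ht] at this
  exact norm_le_zero_iff.1 this

theorem eq_mildSolution (L : E →L[ℝ] E) {a f : ℝ → E} {T : ℝ} (hT : 0 ≤ T)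
    (ha : IntervalIntegrable a volume 0 T) (hf : IntervalIntegrable f volume 0 T)
    (h : ∀ t ∈ Icc 0 T, a t = ∫ s in (0 : ℝ)..t, (L (a s) + f s)) :
    ∀ t ∈ Icc 0 T, a t = mildSolution L f t := by
  have hsub {s : ℝ} (hs : s ∈ Icc 0 T) : uIcc 0 s ⊆ uIcc 0 T := by
    rw [uIcc_of_le hT, uIcc_of_le hs.1]; exact Icc_subset_Icc_right hs.2
  have hLa : IntervalIntegrable (fun s => L (a s)) volume 0 T :=
    intervalIntegrable_clm_apply (k := fun _ => L) continuous_const ha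
  -- The equation itself exhibits the merely integrable `a` as a primitive, which supplies the
  -- continuity needed for uniqueness.
  have hac : ContinuousOn a (Icc 0 T) := by
    have h1 := intervalIntegral.continuousOn_primitive_interval' (hLa.add hf) left_mem_uIcc
    rw [uIcc_of_le hT] at h1
    exact h1.congr h
  have hmc := continuousOn_mildSolution L hT hf
  have hLm : IntervalIntegrable (fun s => L (mildSolution L f s)) volume 0 T :=
    ContinuousOn.intervalIntegrable (by
      rw [uIcc_of_le hT]; exact L.continuous.comp_continuousOn hmc)
  intro t ht
  refine sub_eq_zero.1 (eq_zero_of_eq_integral_clm L hT (hac.sub hmc) (fun t ht => ?_) t ht)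
  have hs := hsub ht
  simp only [Pi.sub_apply, map_sub]
  rw [h t ht, mildSolution_eq_integral L ht.1 (hf.mono_set hs),
    intervalIntegral.integral_add (hLa.mono_set hs) (hf.mono_set hs),
    intervalIntegral.integral_add (hLm.mono_set hs) (hf.mono_set hs),
    intervalIntegral.integral_sub (hLa.mono_set hs) (hLm.mono_set hs)]
  abel

end

/-! ### Decay of the exponential of a normal matrix -/

open scoped Matrix.Norms.L2Operator in
-- After complexification `τH` is normal, so the functional calculus bounds the norm of its
-- exponential by any bound for `|e^z| = e^{Re z}` on its spectrum. Without normality a factor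
-- depending on `H` could appear and spoil uniformity in `n`.
theorem norm_exp_smul_toEuclideanCLM_le {d : ℕ} {H : Matrix (Fin d) (Fin d) ℝ} {c : ℝ}
    (hH : IsNormalWithAbscissaLE H c) {τ : ℝ} (hτ : 0 ≤ τ) :
    ‖NormedSpace.exp (τ • Matrix.toEuclideanCLM (𝕜 := ℝ) H)‖ ≤ Real.exp (c * τ) := by
  set M : Matrix (Fin d) (Fin d) ℝ := NormedSpace.exp (τ • H) with hM
  set Hc : Matrix (Fin d) (Fin d) ℂ := H.map (algebraMap ℝ ℂ) with hHc
  set Mc : Matrix (Fin d) (Fin d) ℂ := M.map (algebraMap ℝ ℂ) with hMc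
  have h1 : NormedSpace.exp (τ • Matrix.toEuclideanCLM (𝕜 := ℝ) H)
      = Matrix.toEuclideanCLM (𝕜 := ℝ) M := by
    let +nondep : NormedAlgebra ℚ (Matrix (Fin d) (Fin d) ℝ) := .restrictScalars ℚ ℝ _
    rw [← map_smul, hM]
    refine (NormedSpace.map_exp (Matrix.toEuclideanCLM (𝕜 := ℝ) (n := Fin d)) ?_ _).symm
    exact (AddMonoidHomClass.isometry_of_norm (Matrix.toEuclideanCLM (𝕜 := ℝ) (n := Fin d))
      fun A => (Matrix.cstar_norm_def A).symm).continuous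
  have h2 : Mc = NormedSpace.exp ((τ : ℂ) • Hc) := by
    let +nondep : NormedAlgebra ℚ (Matrix (Fin d) (Fin d) ℝ) := .restrictScalars ℚ ℝ _
    have := NormedSpace.map_exp ((algebraMap ℝ ℂ).mapMatrix (m := Fin d))
      (continuous_id.matrix_map Complex.continuous_ofReal) (τ • H)
    refine this.trans (congrArg NormedSpace.exp ?_)
    ext i j
    simp [hHc]
  have hnorm : IsStarNormal Hc := by
    refine ⟨?_⟩
    have hs : star Hc = (Hᵀ).map (algebraMap ℝ ℂ) := by
      ext i j; simp [hHc, Matrix.star_apply]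
    rw [hs, Commute, SemiconjBy, hHc, ← Matrix.map_mul, ← Matrix.map_mul, hH.1]
  have h3 : ‖Mc‖ ≤ Real.exp (c * τ) := by
    have hn : IsStarNormal ((τ : ℂ) • Hc) := by
      refine ⟨?_⟩
      rw [star_smul]
      exact (hnorm.star_comm_self.smul_left _).smul_right _
    rw [h2, ← CFC.exp_eq_normedSpace_exp (𝕜 := ℂ) hn]
    refine norm_cfc_le (Real.exp_pos _).le fun z hz => ?_
    rw [← Complex.exp_eq_exp_ℂ, Complex.norm_exp]
    refine Real.exp_le_exp.2 ?_
    -- Spectral points of `τH` are divided by `τ` to reach the spectrum of `H`; `τ = 0` is treated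
    -- apart.
    rcases hτ.eq_or_lt with rfl | hτ0
    · have : z = 0 := by
        by_contra h0
        refine hz ?_
        rw [spectrum.mem_resolventSet_iff]
        simpa using (isUnit_iff_ne_zero.2 h0).map (algebraMap ℂ (Matrix (Fin d) (Fin d) ℂ))
      simp [this]
    · have hτc : (τ : ℂ) ≠ 0 := by exact_mod_cast hτ0.ne'
      have hz' : (Units.mk0 (τ : ℂ) hτc) • ((τ : ℂ)⁻¹ * z)
          ∈ spectrum ℂ ((Units.mk0 (τ : ℂ) hτc) • Hc) := by
        rw [Units.smul_def, Units.smul_def, Units.val_mk0, smul_eq_mul, mul_inv_cancel_left₀ hτc]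
        exact hz
      have := hH.2 _ (spectrum.smul_mem_smul_iff.1 hz')
      rw [← Complex.ofReal_inv, Complex.re_ofReal_mul, inv_mul_le_iff₀ hτ0] at this
      linarith
  rw [h1]
  refine ContinuousLinearMap.opNorm_le_bound _ (Real.exp_pos _).le fun x => ?_
  -- The inclusion of real vectors into complex ones is isometric and intertwines `M` with `Mc`, so
  -- the complex bound descends.
  set xc : EuclideanSpace ℂ (Fin d) := WithLp.toLp 2 fun i => (x i : ℂ) with hxc
  have hx : ‖xc‖ = ‖x‖ := by simp [EuclideanSpace.norm_eq, hxc]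
  have hy : ‖Matrix.toEuclideanCLM (𝕜 := ℂ) Mc xc‖ = ‖Matrix.toEuclideanCLM (𝕜 := ℝ) M x‖ := by
    have (i : Fin d) : Matrix.toEuclideanCLM (𝕜 := ℂ) Mc xc i
        = (Matrix.toEuclideanCLM (𝕜 := ℝ) M x i : ℝ) := by
      simp [Matrix.ofLp_toEuclideanCLM, Matrix.mulVec, dotProduct, hMc, hxc]
    simp [EuclideanSpace.norm_eq, this]
  rw [← hy, ← hx]
  exact (ContinuousLinearMap.le_opNorm _ _).trans
    (mul_le_mul_of_nonneg_right (by rwa [← Matrix.cstar_norm_def]) (norm_nonneg _))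

/-! ### Square-integrable processes and testing of the equation -/

section

variable {α Ω E : Type*} {mα : MeasurableSpace α} {mΩ : MeasurableSpace Ω}
  [NormedAddCommGroup E]

/-- Cauchy–Schwarz against the constant one, from nonnegativity of the integrated squared deviation
from the mean `I / m`. -/
theorem MeasureTheory.MemLp.sq_integral_norm_le {μ : Measure α} [IsFiniteMeasure μ] {u : α → E}
    (hu : MemLp u 2 μ) : (∫ x, ‖u x‖ ∂μ) ^ 2 ≤ μ.real univ * ∫ x, ‖u x‖ ^ 2 ∂μ := by
  rcases eq_or_ne μ 0 with rfl | hμ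
  · simp
  have h1 : Integrable (fun x => ‖u x‖) μ := (hu.integrable (by norm_num)).norm
  have h2 : Integrable (fun x => ‖u x‖ ^ 2) μ := hu.integrable_norm_pow (by norm_num)
  set m := μ.real univ
  set I := ∫ x, ‖u x‖ ∂μ
  have hm : 0 < m := by
    have := NeZero.mk hμ
    exact measureReal_univ_pos
  have h3 : 0 ≤ ∫ x, (‖u x‖ - I / m) ^ 2 ∂μ := integral_nonneg fun x => sq_nonneg _
  have h4 : ∫ x, (‖u x‖ - I / m) ^ 2 ∂μ = ∫ x, ‖u x‖ ^ 2 ∂μ - 2 * (I / m) * I + (I / m) ^ 2 * m := by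
    have e : ∀ x, (‖u x‖ - I / m) ^ 2 = ‖u x‖ ^ 2 - 2 * (I / m) * ‖u x‖ + (I / m) ^ 2 := by
      intro x; ring
    have h5 : Integrable (fun x => ‖u x‖ ^ 2 - 2 * (I / m) * ‖u x‖) μ := h2.sub (h1.const_mul _)
    simp_rw [e]
    rw [integral_add h5 (integrable_const _), integral_sub h2 (h1.const_mul _),
      integral_const_mul, integral_const, smul_eq_mul, mul_comm m]
  have h5 : m * (∫ x, ‖u x‖ ^ 2 ∂μ - 2 * (I / m) * I + (I / m) ^ 2 * m)
      = m * ∫ x, ‖u x‖ ^ 2 ∂μ - I ^ 2 := by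
    field_simp
    ring
  rw [h4] at h3
  have := mul_nonneg hm.le h3
  linarith

theorem MeasureTheory.MemLp.ae_prod_memLp_left {μ : Measure α} [SFinite μ] {P : Measure Ω}
    [SFinite P] {X : α → Ω → E} (hX : MemLp (Function.uncurry X) 2 (μ.prod P)) :
    ∀ᵐ ω ∂P, MemLp (fun s => X s ω) 2 μ := by
  have h1 := (memLp_two_iff_integrable_sq_norm hX.1).1 hX
  have hsw := hX.1.prod_swap.prodMk_left
  filter_upwards [h1.prod_left_ae, hsw] with ω hω hm
  exact (memLp_two_iff_integrable_sq_norm hm).2 hω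

theorem MeasureTheory.MemLp.prod_Ioc {P : Measure Ω} [SFinite P] {X : ℝ → Ω → E} {T t : ℝ}
    (hX : MemLp (Function.uncurry X) 2 ((volume.restrict (Icc 0 T)).prod P)) (ht : t ≤ T) :
    MemLp (Function.uncurry X) 2 ((volume.restrict (Ioc 0 t)).prod P) :=
  hX.mono_measure (Measure.prod_mono (Measure.restrict_mono
    (Ioc_subset_Icc_self.trans (Icc_subset_Icc_right ht)) le_rfl) le_rfl)

variable [NormedSpace ℝ E]

theorem MeasureTheory.MemLp.integral_prod_left {μ : Measure α} [IsFiniteMeasure μ] {P : Measure Ω}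
    [SFinite P] {X : α → Ω → E} (hX : MemLp (Function.uncurry X) 2 (μ.prod P)) :
    MemLp (fun ω => ∫ s, X s ω ∂μ) 2 P := by
  have h1 := (memLp_two_iff_integrable_sq_norm hX.1).1 hX
  have hm : AEStronglyMeasurable (fun ω => ∫ s, X s ω ∂μ) P := hX.1.prod_swap.integral_prod_right'
  refine (memLp_two_iff_integrable_sq_norm hm).2
    ((h1.integral_prod_right.const_mul (μ.real univ)).mono' (hm.norm.pow 2) ?_)
  filter_upwards [hX.ae_prod_memLp_left] with ω hω
  rw [Real.norm_of_nonneg (by positivity)]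
  exact (pow_le_pow_left₀ (norm_nonneg _) (norm_integral_le_integral_norm _) 2).trans
    hω.sq_integral_norm_le

theorem MeasureTheory.MemLp.integrable_smul_of_two {μ : Measure α} {g : α → ℝ} {X : α → E}
    (hg : MemLp g 2 μ) (hX : MemLp X 2 μ) : Integrable (fun x => g x • X x) μ :=
  memLp_one_iff_integrable.1 (hX.smul hg)

variable [CompleteSpace E]

/-- Testing a linear stochastic integral equation with a square-integrable random variable gives a
deterministic linear equation. -/
theorem integral_smul_eq_mildSolution {P : Measure Ω} [IsFiniteMeasure P] {T : ℝ} (hT : 0 ≤ T)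
    (L : E →L[ℝ] E) {Y N : ℝ → Ω → E}
    (hY : MemLp (Function.uncurry Y) 2 ((volume.restrict (Icc 0 T)).prod P))
    (hN : ∀ t ∈ Icc 0 T, MemLp (N t) 2 P)
    (hYN : ∀ t ∈ Icc 0 T, ∀ᵐ ω ∂P, Y t ω = N t ω + ∫ s in (0 : ℝ)..t, L (Y s ω))
    {g : Ω → ℝ} (hg : MemLp g 2 P) {f : ℝ → E} (hf : IntervalIntegrable f volume 0 T)
    (hgN : ∀ t ∈ Icc 0 T, ∫ ω, g ω • N t ω ∂P = ∫ s in (0 : ℝ)..t, f s) :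
    ∀ t ∈ Icc 0 T, ∫ ω, g ω • Y t ω ∂P = mildSolution L f t := by
  have hprod {t : ℝ} (ht : t ≤ T) :
      Integrable (fun p : ℝ × Ω => g p.2 • Y p.1 p.2) ((volume.restrict (Ioc 0 t)).prod P) :=
    (hg.comp_snd _).integrable_smul_of_two (hY.prod_Ioc ht)
  have ha : IntervalIntegrable (fun s => ∫ ω, g ω • Y s ω ∂P) volume 0 T := by
    rw [intervalIntegrable_iff_integrableOn_Ioc_of_le hT]
    exact (hprod le_rfl).integral_prod_left
  -- It remains to see that `E[g Y(t)]` solves the integral equation; Fubini moves the expectation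
  -- inside the drift integral.
  refine eq_mildSolution L hT ha hf fun t ht => ?_
  have hsub : uIcc 0 t ⊆ uIcc 0 T := by
    rw [uIcc_of_le hT, uIcc_of_le ht.1]; exact Icc_subset_Icc_right ht.2
  have hLY : MemLp (Function.uncurry fun s ω => L (Y s ω)) 2 ((volume.restrict (Ioc 0 t)).prod P) :=
    L.comp_memLp' (hY.prod_Ioc ht.2)
  have hV : MemLp (fun ω => ∫ s in (0 : ℝ)..t, L (Y s ω)) 2 P := by
    simp_rw [intervalIntegral.integral_of_le ht.1]
    exact hLY.integral_prod_left
  have e1 : ∫ ω, g ω • Y t ω ∂P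
      = ∫ ω, (g ω • N t ω + g ω • ∫ s in (0 : ℝ)..t, L (Y s ω)) ∂P := by
    refine integral_congr_ae ?_
    filter_upwards [hYN t ht] with ω hω
    rw [hω, smul_add]
  have e2 : ∫ ω, g ω • (∫ s in (0 : ℝ)..t, L (Y s ω)) ∂P
      = ∫ s in (0 : ℝ)..t, L (∫ ω, g ω • Y s ω ∂P) := by
    have hi : Integrable (Function.uncurry fun (s : ℝ) ω => g ω • L (Y s ω))
        ((volume.restrict (Ioc 0 t)).prod P) :=
      (hg.comp_snd _).integrable_smul_of_two hLY
    simp_rw [← intervalIntegral.integral_smul, intervalIntegral.integral_of_le ht.1]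
    rw [← integral_integral_swap hi]
    refine integral_congr_ae ?_
    filter_upwards [(hprod ht.2).prod_right_ae] with s hs
    rw [← ContinuousLinearMap.integral_comp_comm L hs]
    simp
  rw [e1, integral_add (hg.integrable_smul_of_two (hN t ht)) (hg.integrable_smul_of_two hV), e2,
    hgN t ht, intervalIntegral.integral_add
      (intervalIntegrable_clm_apply (k := fun _ => L) continuous_const (ha.mono_set hsub))
      (hf.mono_set hsub), add_comm]

end

/-! ### The isometry for solutions of linear equations -/

theorem intervalIntegrable_inner_smul {E : Type*} [NormedAddCommGroup E] [InnerProductSpace ℝ E]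
    {T : ℝ} {σ : ℝ → E} (hσ : MemLp σ 2 (volume.restrict (Icc 0 T))) (hT : 0 ≤ T) (v : E) (r : ℝ) :
    IntervalIntegrable (fun s => inner ℝ v ((Icc 0 r).indicator σ s) • σ s) volume 0 T := by
  have h : IntegrableOn (fun s => inner ℝ v ((Icc 0 r).indicator σ s) • σ s) (Icc 0 T) volume :=
    ((innerSL ℝ v).comp_memLp' (hσ.indicator measurableSet_Icc)).integrable_smul_of_two hσ
  exact (intervalIntegrable_iff_integrableOn_Icc_of_le hT).2 h

section

variable {Ω E : Type*} {mΩ : MeasurableSpace Ω} {P : Measure Ω} [IsProbabilityMeasure P]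
  {W : ℝ≥0 → Ω → ℝ} [NormedAddCommGroup E] [InnerProductSpace ℝ E]

theorem IsWienerIntegral.integral_inner_mul_inner (hW : IsPreBrownianReal W P) {T : ℝ} {σ : ℝ → E}
    (hσ : MemLp σ 2 (volume.restrict (Icc 0 T))) {r t : ℝ} (hr : r ∈ Icc 0 T) (ht : t ∈ Icc 0 T)
    {I J : Ω → E} (hI : IsWienerIntegral P W σ r I) (hJ : IsWienerIntegral P W σ t J) (v w : E) :
    ∫ ω, inner ℝ v (I ω) * inner ℝ w (J ω) ∂P
      = ∫ s in (0 : ℝ)..t, inner ℝ v ((Icc 0 r).indicator σ s) * inner ℝ w (σ s) := by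
  have hsub {r : ℝ} (hr : r ∈ Icc 0 T) (v : E) :
      MemLp (fun s => inner ℝ v (σ s)) 2 (volume.restrict (Icc 0 r)) :=
    (innerSL ℝ v).comp_memLp' (hσ.mono_measure
      (Measure.restrict_mono (Icc_subset_Icc_right hr.2) le_rfl))
  have h := (hJ.map (innerSL ℝ w)).integral_inner hW (hI.map (innerSL ℝ v)) (hsub ht w) (hsub hr v)
  simp only [innerSL_apply_apply, RCLike.inner_apply, conj_trivial] at h
  rw [h, intervalIntegral.integral_of_le ht.1, ← integral_Icc_eq_integral_Ioc,
    ← integral_indicator measurableSet_Icc]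
  refine integral_congr_ae (ae_of_all _ fun s => ?_)
  by_cases h1 : s ∈ Icc 0 r <;> by_cases h2 : s ∈ Icc 0 t <;> simp [-mem_Icc, h1, h2]

variable [CompleteSpace E]

/-- The cutoff at `r` sits in the integrand so that the covariance is a primitive in `t`, the form
required of the forcing in `integral_smul_eq_mildSolution`. -/
theorem IsWienerIntegral.integral_inner_smul (hW : IsPreBrownianReal W P) {T : ℝ} {σ : ℝ → E}
    (hσ : MemLp σ 2 (volume.restrict (Icc 0 T))) {r t : ℝ} (hr : r ∈ Icc 0 T) (ht : t ∈ Icc 0 T)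
    {I J : Ω → E} (hI : IsWienerIntegral P W σ r I) (hJ : IsWienerIntegral P W σ t J) (v : E) :
    ∫ ω, inner ℝ v (I ω) • J ω ∂P
      = ∫ s in (0 : ℝ)..t, inner ℝ v ((Icc 0 r).indicator σ s) • σ s := by
  have hi : Integrable (fun ω => inner ℝ v (I ω) • J ω) P :=
    ((innerSL ℝ v).comp_memLp' hI.1).integrable_smul_of_two hJ.1
  have hj : IntervalIntegrable (fun s => inner ℝ v ((Icc 0 r).indicator σ s) • σ s) volume 0 t :=
    (intervalIntegrable_inner_smul hσ (ht.1.trans ht.2) v r).mono_set (by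
      rw [uIcc_of_le (ht.1.trans ht.2), uIcc_of_le ht.1]; exact Icc_subset_Icc_right ht.2)
  refine ext_inner_left ℝ fun w => ?_
  have e := integral_inner_mul_inner hW hσ hr ht hI hJ v w
  rw [intervalIntegral.integral_of_le ht.1] at e ⊢
  rw [← _root_.integral_inner hi,
    ← _root_.integral_inner ((intervalIntegrable_iff_integrableOn_Ioc_of_le ht.1).1 hj)]
  simpa only [real_inner_smul_right] using e

/-- The Itô isometry for the solution of a linear equation with additive noise. -/
theorem integral_norm_sq_eq_of_linear_sde [FiniteDimensional ℝ E] (hW : IsPreBrownianReal W P)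
    {T : ℝ} {σ : ℝ → E} (hσ : MemLp σ 2 (volume.restrict (Icc 0 T)))
    (L : E →L[ℝ] E) {Y N : ℝ → Ω → E}
    (hY : MemLp (Function.uncurry Y) 2 ((volume.restrict (Icc 0 T)).prod P))
    (hN : ∀ t ∈ Icc 0 T, IsWienerIntegral P W σ t (N t))
    (hYN : ∀ t ∈ Icc 0 T, ∀ᵐ ω ∂P, Y t ω = N t ω + ∫ s in (0 : ℝ)..t, L (Y s ω))
    {t : ℝ} (ht : t ∈ Icc 0 T) : MemLp (Y t) 2 P ∧
    ∫ ω, ‖Y t ω‖ ^ 2 ∂P = ∫ s in (0 : ℝ)..t, ‖NormedSpace.exp ((t - s) • L) (σ s)‖ ^ 2 := by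
  have hT : 0 ≤ T := ht.1.trans ht.2
  have hYt : MemLp (Y t) 2 P := by
    have hV : MemLp (fun ω => ∫ s in (0 : ℝ)..t, L (Y s ω)) 2 P := by
      simp_rw [intervalIntegral.integral_of_le ht.1]
      exact MemLp.integral_prod_left (X := fun s ω => L (Y s ω)) (L.comp_memLp' (hY.prod_Ioc ht.2))
    refine ((hN t ht).1.add hV).ae_eq ?_
    filter_upwards [hYN t ht] with ω hω
    exact hω.symm
  refine ⟨hYt, ?_⟩
  set z : ℝ → E := fun s => NormedSpace.exp ((t - s) • L) (σ s) with hz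
  have hzs (s : ℝ) : NormedSpace.exp ((t - s) • L) (σ s) = z s := rfl
  have hk : Continuous fun s : ℝ => NormedSpace.exp ((t - s) • L) :=
    (continuous_exp_smul L).comp (continuous_const.sub continuous_id)
  have hσt : MemLp σ 2 (volume.restrict (Icc 0 t)) :=
    hσ.mono_measure (Measure.restrict_mono (Icc_subset_Icc_right ht.2) le_rfl)
  have hzt : MemLp z 2 (volume.restrict (Ioc 0 t)) := by
    obtain ⟨C, hC⟩ := (isCompact_Icc (a := 0) (b := t)).exists_bound_of_continuousOn hk.continuousOn
    have hσ' : MemLp σ 2 (volume.restrict (Ioc 0 t)) :=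
      hσt.mono_measure (Measure.restrict_mono Ioc_subset_Icc_self le_rfl)
    refine hσ'.of_le_mul (c := C) ?_ ?_
    · exact (isBoundedBilinearMap_apply (𝕜 := ℝ) (E := E)
        (F := E)).continuous.comp_aestronglyMeasurable (hk.aestronglyMeasurable.prodMk hσ'.1)
    · filter_upwards [ae_restrict_mem measurableSet_Ioc] with s hs
      exact (ContinuousLinearMap.le_opNorm _ _).trans
        (mul_le_mul_of_nonneg_right (hC s (Ioc_subset_Icc_self hs)) (norm_nonneg _))
  have hσt' : MemLp σ 2 (volume.restrict (Ioc 0 t)) :=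
    hσt.mono_measure (Measure.restrict_mono Ioc_subset_Icc_self le_rfl)
  have hzσ (v : E) : IntervalIntegrable (fun s => inner ℝ v (z s) • σ s) volume 0 t := by
    rw [intervalIntegrable_iff_integrableOn_Ioc_of_le ht.1]
    exact ((innerSL ℝ v).comp_memLp' hzt).integrable_smul_of_two hσt'
  -- First test, with `g = ⟨v, N r⟩`.
  have hNY (v : E) {r : ℝ} (hr : r ∈ Icc 0 T) : ∫ ω, inner ℝ v (N r ω) • Y t ω ∂P
      = ∫ s in (0 : ℝ)..t, inner ℝ v ((Icc 0 r).indicator σ s) • z s := by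
    have := integral_smul_eq_mildSolution hT L hY (fun t ht => (hN t ht).1) hYN
      ((innerSL ℝ v).comp_memLp' (hN r hr).1) (intervalIntegrable_inner_smul hσ hT v r)
      (fun t ht => (hN r hr).integral_inner_smul hW hσ hr ht (hN t ht) v) t ht
    simpa only [mildSolution, map_smul, hzs, Function.comp_apply, innerSL_apply_apply] using this
  -- The transpose of the previous covariance, read off by pairing with `w`. For `r ≤ t` the cutoff
  -- becomes the upper limit, which again gives a primitive, now in `r`.
  have hYN_z (v : E) {r : ℝ} (hr : r ∈ Icc 0 t) : ∫ ω, inner ℝ v (Y t ω) • N r ω ∂P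
      = ∫ s in (0 : ℝ)..r, inner ℝ v (z s) • σ s := by
    have hrT : r ∈ Icc 0 T := ⟨hr.1, hr.2.trans ht.2⟩
    have hi : Integrable (fun ω => inner ℝ v (Y t ω) • N r ω) P :=
      ((innerSL ℝ v).comp_memLp' hYt).integrable_smul_of_two (hN r hrT).1
    have hj (w : E) : Integrable (fun ω => inner ℝ w (N r ω) • Y t ω) P :=
      ((innerSL ℝ w).comp_memLp' (hN r hrT).1).integrable_smul_of_two hYt
    have hzr : Integrable (fun s => inner ℝ v (z s) • σ s) (volume.restrict (Ioc 0 r)) :=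
      ((intervalIntegrable_iff_integrableOn_Ioc_of_le ht.1).1 (hzσ v)).mono_set
        (Ioc_subset_Ioc_right hr.2)
    refine ext_inner_left ℝ fun w => ?_
    have hzw : Integrable (fun s => inner ℝ w ((Icc 0 r).indicator σ s) • z s)
        (volume.restrict (Ioc 0 t)) :=
      ((innerSL ℝ w).comp_memLp' (hσt'.indicator measurableSet_Icc)).integrable_smul_of_two hzt
    have e := congrArg (fun y => inner ℝ v y) (hNY w hrT)
    simp only [intervalIntegral.integral_of_le ht.1] at e
    rw [← integral_inner (hj w), ← integral_inner hzw] at e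
    rw [intervalIntegral.integral_of_le hr.1, ← integral_inner hi, ← integral_inner hzr]
    simp only [real_inner_smul_right] at e ⊢
    simp_rw [mul_comm (inner ℝ v _)]
    rw [e]
    have e2 : ∀ s, inner ℝ w ((Icc 0 r).indicator σ s) * inner ℝ v (z s)
        = (Icc 0 r).indicator (fun s => inner ℝ w (σ s) * inner ℝ v (z s)) s := by
      intro s
      by_cases hs : s ∈ Icc 0 r <;> simp [-mem_Icc, hs]
    simp_rw [e2]
    rw [setIntegral_indicator measurableSet_Icc]
    have e3 : Ioc 0 t ∩ Icc 0 r = Ioc 0 r := by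
      ext s
      simp only [mem_inter_iff, mem_Ioc, mem_Icc]
      exact ⟨fun h => ⟨h.1.1, h.2.2⟩, fun h => ⟨⟨h.1, h.2.trans hr.2⟩, h.1.le, h.2⟩⟩
    rw [e3]
  -- Second test, with `g = ⟨v, Y t⟩`, on the horizon `t` because the covariance with `N r` is known
  -- only for `r ≤ t`.
  have hY_sq (v : E) : ∫ ω, inner ℝ v (Y t ω) ^ 2 ∂P = ∫ s in (0 : ℝ)..t, inner ℝ v (z s) ^ 2 := by
    have hYt' : MemLp (Function.uncurry Y) 2 ((volume.restrict (Icc 0 t)).prod P) :=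
      hY.mono_measure (Measure.prod_mono (Measure.restrict_mono (Icc_subset_Icc_right ht.2) le_rfl)
        le_rfl)
    have e := integral_smul_eq_mildSolution ht.1 L hYt'
      (fun r hr => (hN r ⟨hr.1, hr.2.trans ht.2⟩).1) (fun r hr => hYN r ⟨hr.1, hr.2.trans ht.2⟩)
      ((innerSL ℝ v).comp_memLp' hYt) (hzσ v) (fun r hr => hYN_z v hr) t ⟨ht.1, le_rfl⟩
    simp only [mildSolution, map_smul, hzs] at e
    have e' := congrArg (fun y => inner ℝ v y) e
    simp only [intervalIntegral.integral_of_le ht.1] at e'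
    rw [← integral_inner, ← integral_inner] at e'
    · simpa only [intervalIntegral.integral_of_le ht.1, Function.comp_apply, innerSL_apply_apply,
        real_inner_smul_right, ← sq] using e'
    · exact ((innerSL ℝ v).comp_memLp' hzt).integrable_smul_of_two hzt
    · exact ((innerSL ℝ v).comp_memLp' hYt).integrable_smul_of_two hYt
  set b := stdOrthonormalBasis ℝ E
  have hb (y : E) : ‖y‖ ^ 2 = ∑ i, inner ℝ (b i) y ^ 2 := by
    rw [← b.sum_sq_norm_inner_right y]
    simp
  rw [intervalIntegral.integral_of_le ht.1]
  simp_rw [hzs, hb]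
  have iY (i) : Integrable (fun ω => inner ℝ (b i) (Y t ω) ^ 2) P :=
    ((innerSL ℝ (b i)).comp_memLp' hYt).integrable_sq
  have iz (i) : Integrable (fun s => inner ℝ (b i) (z s) ^ 2) (volume.restrict (Ioc 0 t)) :=
    ((innerSL ℝ (b i)).comp_memLp' hzt).integrable_sq
  rw [integral_finsetSum _ fun i _ => iY i, integral_finsetSum _ fun i _ => iz i]
  refine Finset.sum_congr rfl fun i _ => ?_
  rw [← intervalIntegral.integral_of_le ht.1]
  exact hY_sq (b i)

end

/-! ### Progressively measurable versions by dyadic discretization -/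

section

variable {Ω E : Type*} {mΩ : MeasurableSpace Ω} {P : Measure Ω} [NormedAddCommGroup E]

/-- The sum of the squared distances has finite expectation, so it is almost surely finite and its
terms tend to zero. -/
theorem ae_tendsto_of_summable_integral_norm_sq {u : ℕ → Ω → E} {v : Ω → E} {b : ℕ → ℝ}
    (hu : ∀ k, MemLp (fun ω => u k ω - v ω) 2 P) (hb : Summable b)
    (hub : ∀ k, ∫ ω, ‖u k ω - v ω‖ ^ 2 ∂P ≤ b k) :
    ∀ᵐ ω ∂P, Tendsto (fun k => u k ω) atTop (𝓝 (v ω)) := by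
  have hi (k) : Integrable (fun ω => ‖u k ω - v ω‖ ^ 2) P := (hu k).integrable_norm_pow (by norm_num)
  have hm (k) : AEMeasurable (fun ω => ENNReal.ofReal (‖u k ω - v ω‖ ^ 2)) P :=
    (hi k).aemeasurable.ennreal_ofReal
  have h : ∫⁻ ω, ∑' k, ENNReal.ofReal (‖u k ω - v ω‖ ^ 2) ∂P ≠ ∞ := by
    rw [lintegral_tsum hm]
    refine ne_top_of_le_ne_top hb.tsum_ofReal_ne_top (ENNReal.tsum_le_tsum fun k => ?_)
    rw [← ofReal_integral_eq_lintegral_ofReal (hi k) (ae_of_all _ fun ω => by positivity)]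
    exact ENNReal.ofReal_le_ofReal (hub k)
  filter_upwards [ae_lt_top' (AEMeasurable.tsum hm) h] with ω hω
  have h0 := ENNReal.tendsto_atTop_zero_of_tsum_ne_top hω.ne
  have h1 : Tendsto (fun k => ‖u k ω - v ω‖ ^ 2) atTop (𝓝 0) := by
    have := (ENNReal.tendsto_toReal ENNReal.zero_ne_top).comp h0
    refine this.congr fun k => ?_
    rw [Function.comp_apply, ENNReal.toReal_ofReal (by positivity)]
  rw [tendsto_iff_norm_sub_tendsto_zero]
  have := h1.sqrt
  simpa [Real.sqrt_sq] using this

/-- The largest multiple of `2⁻ᵏ` below a nonnegative number. -/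
def dyadicFloor (k : ℕ) (s : ℝ) : ℝ := (⌊s * 2 ^ k⌋₊ : ℝ) / 2 ^ k

theorem dyadicFloor_nonneg (k : ℕ) (s : ℝ) : 0 ≤ dyadicFloor k s := by
  unfold dyadicFloor; positivity

theorem dyadicFloor_le (k : ℕ) {s : ℝ} (hs : 0 ≤ s) : dyadicFloor k s ≤ s := by
  unfold dyadicFloor
  rw [div_le_iff₀ (by positivity)]
  exact Nat.floor_le (by positivity)

theorem sub_dyadicFloor_le (k : ℕ) (s : ℝ) : s - dyadicFloor k s ≤ (1 / 2) ^ k := by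
  unfold dyadicFloor
  have := Nat.lt_floor_add_one (s * 2 ^ k)
  have h2 : (0 : ℝ) < 2 ^ k := by positivity
  rw [one_div, inv_pow, sub_le_iff_le_add, ← one_div, ← add_div, le_div_iff₀ h2]
  linarith

/-- The pointwise limit of the dyadic left-endpoint discretizations of a process. -/
def dyadicLimit (I : ℝ → Ω → E) (s : ℝ) (ω : Ω) : E :=
  limUnder atTop fun k => I (dyadicFloor k s) ω

/-- Each discretization depends on time through an integer index only, so measurability at each node
gives joint measurability. Capping time at `u` leaves only nodes in `[0, u]`, which is what makes
the limit progressive. -/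
theorem stronglyMeasurable_dyadicLimit [SecondCountableTopology E] [CompleteSpace E]
    {m : MeasurableSpace Ω} {I : ℝ → Ω → E} {u : ℝ} (hu : 0 ≤ u)
    (hI : ∀ s ∈ Icc 0 u, StronglyMeasurable[m] (I s)) :
    StronglyMeasurable fun p : ℝ × Ω => dyadicLimit I (min p.1 u) p.2 := by
  borelize E
  refine StronglyMeasurable.limUnder fun k => Measurable.stronglyMeasurable ?_
  set f : ℕ × Ω → E := fun p => I (min (p.1 / 2 ^ k) u) p.2
  have hf : Measurable f := measurable_from_prod_countable_right fun j =>
    (hI (min ((j : ℝ) / 2 ^ k) u) ⟨le_min (by positivity) hu, min_le_right _ _⟩).measurable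
  have hg : Measurable fun p : ℝ × Ω => (⌊min p.1 u * 2 ^ k⌋₊, p.2) :=
    (Nat.measurable_floor.comp ((measurable_fst.min measurable_const).mul_const _)).prodMk
      measurable_snd
  convert hf.comp hg using 2 with p
  have : dyadicFloor k (min p.1 u) ≤ u := by
    rcases le_total 0 (min p.1 u) with h | h
    · exact (dyadicFloor_le k h).trans (min_le_right _ _)
    · have : ⌊min p.1 u * 2 ^ k⌋₊ = 0 :=
        Nat.floor_of_nonpos (mul_nonpos_of_nonpos_of_nonneg h (by positivity))
      simp [dyadicFloor, this, hu]
  have e : dyadicFloor k (min p.1 u) = (⌊min p.1 u * 2 ^ k⌋₊ : ℝ) / 2 ^ k := rfl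
  simp only [Function.comp_apply, f]
  rw [← e, min_eq_left this]

end

section

variable {Ω E : Type*} {mΩ : MeasurableSpace Ω} {P : Measure Ω} [IsProbabilityMeasure P]
  {W : ℝ≥0 → Ω → ℝ} [NormedAddCommGroup E] [InnerProductSpace ℝ E]

/-- By the isometry the left side is `∫ |σ|²` over `(r, t]`. Along dyadic approximations of `t` the
bound is geometric, hence summable. -/
theorem IsWienerIntegral.integral_norm_sub_sq_le (hW : IsPreBrownianReal W P) {T C : ℝ} {σ : ℝ → E}
    (hσ : MemLp σ 2 (volume.restrict (Icc 0 T)))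
    (hC : ∀ᵐ s ∂volume.restrict (Icc 0 T), ‖σ s‖ ≤ C) {r t : ℝ} (hr : 0 ≤ r) (hrt : r ≤ t)
    (ht : t ≤ T) {I J : Ω → E} (hI : IsWienerIntegral P W σ r I) (hJ : IsWienerIntegral P W σ t J) :
    ∫ ω, ‖I ω - J ω‖ ^ 2 ∂P ≤ C ^ 2 * (t - r) := by
  have hsub {r : ℝ} (hr : r ≤ T) : MemLp σ 2 (volume.restrict (Icc 0 r)) :=
    hσ.mono_measure (Measure.restrict_mono (Icc_subset_Icc_right hr) le_rfl)
  have hσr := hsub (hrt.trans ht)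
  have hσt := hsub ht
  have e1 := hI.1.integral_inner_sub_self hJ.1
  have e2 := ((memLp_indicator_iff_restrict (p := 2) measurableSet_Icc).2
    hσr).integral_inner_sub_self ((memLp_indicator_iff_restrict measurableSet_Icc).2 hσt)
  rw [hI.integral_inner hW hI hσr hσr, hI.integral_inner hW hJ hσr hσt,
    hJ.integral_inner hW hJ hσt hσt, ← e2] at e1
  simp_rw [real_inner_self_eq_norm_sq] at e1
  have e3 : ∀ s, ‖(Icc 0 r).indicator σ s - (Icc 0 t).indicator σ s‖ ^ 2
      = (Ioc r t).indicator (fun s => ‖σ s‖ ^ 2) s := by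
    intro s
    have h3 : s ∈ Ioc r t ↔ ¬ (s ∈ Icc 0 r) ∧ s ∈ Icc 0 t := by
      simp only [mem_Ioc, mem_Icc, not_and, not_le]
      exact ⟨fun h => ⟨fun _ => h.1, hr.trans h.1.le, h.2⟩, fun h => ⟨h.1 h.2.1, h.2.2⟩⟩
    by_cases h1 : s ∈ Icc 0 r
    · have h2 : s ∈ Icc 0 t := Icc_subset_Icc_right hrt h1
      have h4 : s ∉ Ioc r t := fun h => (h3.1 h).1 h1
      simp only [indicator, h1, h2, h4, if_true, if_false, sub_self, norm_zero]
      norm_num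
    · by_cases h2 : s ∈ Icc 0 t
      · simp only [indicator, h1, h2, h3.2 ⟨h1, h2⟩, if_true, if_false, zero_sub, norm_neg]
      · have h4 : s ∉ Ioc r t := fun h => h2 (h3.1 h).2
        simp only [indicator, h1, h2, h4, if_false, sub_self, norm_zero]
        norm_num
  simp_rw [e3] at e1
  have hsub' : Ioc r t ⊆ Icc 0 T := fun s hs => ⟨hr.trans hs.1.le, hs.2.trans ht⟩
  rw [e1, integral_indicator measurableSet_Ioc]
  have h5 : ∫ s in Ioc r t, ‖σ s‖ ^ 2 ≤ ∫ _s in Ioc r t, C ^ 2 := by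
    refine integral_mono_ae ?_ (integrable_const _) ?_
    · exact ((memLp_two_iff_integrable_sq_norm hσ.1).1 hσ).mono_measure
        (Measure.restrict_mono hsub' le_rfl)
    · filter_upwards [ae_restrict_of_ae_restrict_of_subset hsub' hC] with s hs
      exact pow_le_pow_left₀ (norm_nonneg _) hs 2
  refine h5.trans_eq ?_
  rw [setIntegral_const, Real.volume_real_Ioc_of_le hrt, smul_eq_mul, mul_comm]

/-- A progressively measurable version of the Wiener integral process of a bounded function. -/
theorem exists_progressive_isWienerIntegral [SecondCountableTopology E] [CompleteSpace E]
    (hW : IsPreBrownianReal W P) {F : Filtration ℝ≥0 mΩ} (hWF : StronglyAdapted F W)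
    {T C : ℝ} {σ : ℝ → E} (hσ : MemLp σ 2 (volume.restrict (Icc 0 T)))
    (hC : ∀ᵐ s ∂volume.restrict (Icc 0 T), ‖σ s‖ ≤ C) :
    ∃ M : ℝ → Ω → E, (∀ t ∈ Icc 0 T, IsWienerIntegral P W σ t (M t)) ∧
      ∀ t ∈ Icc 0 T, StronglyMeasurable[borel ℝ |>.prod (F t.toNNReal)]
        fun p : ℝ × Ω => M (min p.1 t) p.2 := by
  have hex (s : ℝ) : ∃ I : Ω → E, s ∈ Icc 0 T →
      StronglyMeasurable[F s.toNNReal] I ∧ IsWienerIntegral P W σ s I := by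
    by_cases hs : s ∈ Icc 0 T
    · obtain ⟨I, hI⟩ := exists_isWienerIntegral hW hWF hs.1
        (hσ.mono_measure (Measure.restrict_mono (Icc_subset_Icc_right hs.2) le_rfl))
      exact ⟨I, fun _ => hI⟩
    · exact ⟨0, fun h => absurd h hs⟩
  choose I hI using hex
  refine ⟨dyadicLimit I, fun t ht => ?_, fun t ht => ?_⟩
  · refine (hI t ht).2.congr ?_
    have hd (k) : dyadicFloor k t ∈ Icc 0 T :=
      ⟨dyadicFloor_nonneg k t, (dyadicFloor_le k ht.1).trans ht.2⟩
    have := ae_tendsto_of_summable_integral_norm_sq (P := P) (u := fun k => I (dyadicFloor k t))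
      (v := I t) (b := fun k => C ^ 2 * (1 / 2) ^ k) (fun k => (hI _ (hd k)).2.1.sub (hI t ht).2.1)
      (summable_geometric_two.mul_left _) fun k =>
        ((hI _ (hd k)).2.integral_norm_sub_sq_le hW hσ hC (hd k).1 (dyadicFloor_le k ht.1) ht.2
          (hI t ht).2).trans (mul_le_mul_of_nonneg_left (sub_dyadicFloor_le k t) (sq_nonneg C))
    filter_upwards [this] with ω hω
    exact hω.limUnder_eq.symm
  · refine stronglyMeasurable_dyadicLimit (m := F t.toNNReal) ht.1 fun s hs => ?_
    exact (hI s ⟨hs.1, hs.2.trans ht.2⟩).1.mono (F.mono (Real.toNNReal_le_toNNReal hs.2))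

end

/-! ### Existence of adapted solutions -/

section

variable {Ω E : Type*} {mΩ : MeasurableSpace Ω} {P : Measure Ω} [IsProbabilityMeasure P]
  {W : ℝ≥0 → Ω → ℝ} [NormedAddCommGroup E] [InnerProductSpace ℝ E]

omit [IsProbabilityMeasure P] in
theorem isWienerIntegral_zero (σ : ℝ → E) : IsWienerIntegral P W σ 0 (0 : Ω → E) := by
  refine ⟨MemLp.zero, fun _ => ⟨0, fun _ => 0, fun _ => 0, monotone_const, fun _ => by simp⟩, ?_, ?_⟩
  · simp
  · simp [StepFun.integral]

/-- The variable upper limit becomes an indicator over a fixed domain, so the integral depends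
measurably on time and `ω` together. -/
theorem stronglyMeasurable_integral_Iic_clm_apply {m : MeasurableSpace Ω} {T : ℝ}
    {X : ℝ × Ω → E} (hX : StronglyMeasurable X) {k : ℝ → E →L[ℝ] E} (hk : Continuous k) :
    StronglyMeasurable fun p : ℝ × Ω => ∫ s in Ioc 0 T,
      (Iic p.1).indicator (fun s => k (p.1 - s) (X (s, p.2))) s := by
  have hD : MeasurableSet {q : (ℝ × Ω) × ℝ | q.2 ≤ q.1.1} :=
    measurableSet_le measurable_snd (measurable_fst.comp measurable_fst)
  have h : StronglyMeasurable fun q : (ℝ × Ω) × ℝ => k (q.1.1 - q.2) (X (q.2, q.1.2)) := by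
    have h1 : StronglyMeasurable fun q : (ℝ × Ω) × ℝ => k (q.1.1 - q.2) :=
      hk.stronglyMeasurable.comp_measurable
        ((measurable_fst.comp measurable_fst).sub measurable_snd)
    have h2 : StronglyMeasurable fun q : (ℝ × Ω) × ℝ => X (q.2, q.1.2) :=
      hX.comp_measurable (measurable_snd.prodMk (measurable_snd.comp measurable_fst))
    exact (isBoundedBilinearMap_apply (𝕜 := ℝ) (E := E) (F := E)).continuous.comp_stronglyMeasurable
      (h1.prodMk h2)
  exact (h.indicator hD).integral_prod_right'

theorem mildSolution_eq_integral_Iic (L : E →L[ℝ] E) (f : ℝ → E) {t T : ℝ} (ht : t ∈ Icc 0 T) :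
    mildSolution L f t
      = ∫ s in Ioc 0 T, (Iic t).indicator (fun s => NormedSpace.exp ((t - s) • L) (f s)) s := by
  rw [mildSolution, intervalIntegral.integral_of_le ht.1, setIntegral_indicator measurableSet_Iic,
    Ioc_inter_Iic, min_eq_right ht.2]

variable [SecondCountableTopology E] [CompleteSpace E]

/-- Existence of an adapted solution of a linear equation with bounded additive noise. -/
theorem exists_linear_sde (hW : IsPreBrownianReal W P) {F : Filtration ℝ≥0 mΩ}
    (hWF : StronglyAdapted F W) {T C : ℝ} (hT : 0 ≤ T) {σ : ℝ → E}
    (hσ : MemLp σ 2 (volume.restrict (Icc 0 T)))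
    (hC : ∀ᵐ s ∂volume.restrict (Icc 0 T), ‖σ s‖ ≤ C) (L : E →L[ℝ] E) :
    ∃ Y : ℝ → Ω → E, MemL2Adapted P F T Y ∧
      ∀ t ∈ Icc 0 T, IsWienerIntegral P W σ t fun ω => Y t ω - ∫ s in (0 : ℝ)..t, L (Y s ω) := by
  obtain ⟨M, hM, hMm⟩ := exists_progressive_isWienerIntegral hW hWF hσ hC
  set ν : Measure ℝ := volume.restrict (Icc 0 T)
  set k : ℝ → E →L[ℝ] E := fun s => NormedSpace.exp (s • L) * L with hk_def
  have hk : Continuous k := (continuous_exp_smul L).mul continuous_const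
  have hMsq {t : ℝ} (ht : t ∈ Icc 0 T) : ∫ ω, ‖M t ω‖ ^ 2 ∂P ≤ C ^ 2 * T := by
    have h := (isWienerIntegral_zero (P := P) (W := W) σ).integral_norm_sub_sq_le hW hσ hC le_rfl
      ht.1 ht.2 (hM t ht)
    simp only [Pi.zero_apply, zero_sub, norm_neg, sub_zero] at h
    exact h.trans (mul_le_mul_of_nonneg_left ht.2 (sq_nonneg C))
  have hMT : StronglyMeasurable fun p : ℝ × Ω => M (min p.1 T) p.2 :=
    (hMm T ⟨hT, le_rfl⟩).mono (sup_le_sup le_rfl (MeasurableSpace.comap_mono (F.le _)))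
  have hicc : ∀ᵐ p ∂ν.prod P, p.1 ∈ Icc 0 T :=
    Measure.quasiMeasurePreserving_fst.ae (ae_restrict_mem measurableSet_Icc)
  have hMae : AEStronglyMeasurable (Function.uncurry M) (ν.prod P) := by
    refine ⟨_, hMT, ?_⟩
    filter_upwards [hicc] with p hp
    simp [Function.uncurry, min_eq_left hp.2]
  have hML : MemLp (Function.uncurry M) 2 (ν.prod P) := by
    refine (memLp_two_iff_integrable_sq_norm hMae).2 ((integrable_prod_iff (hMae.norm.pow 2)).2
      ⟨?_, ?_⟩)
    · filter_upwards [ae_restrict_mem measurableSet_Icc] with s hs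
      exact ((hM s hs).1).integrable_norm_pow (by norm_num)
    · refine (integrable_const (C ^ 2 * T)).mono' (hMae.norm.pow 2).norm.integral_prod_right' ?_
      filter_upwards [ae_restrict_mem measurableSet_Icc] with s hs
      rw [Real.norm_of_nonneg (integral_nonneg fun _ => norm_nonneg _)]
      simpa [Function.uncurry] using hMsq hs
  -- Pathwise, `V(t) = ∫₀ᵗ L (V + M) ds`; hence `Y = M + V` satisfies `Y(t) - ∫₀ᵗ L Y ds = M(t)`.
  set V : ℝ → Ω → E := fun t ω => mildSolution L (fun s => L (M s ω)) t with hV_def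
  have hVeq {t u : ℝ} (ht : t ∈ Icc 0 u) (ω : Ω) : V t ω = ∫ s in Ioc 0 u,
      (Iic t).indicator (fun s => k (t - s) (M (min s u) ω)) s := by
    change mildSolution L (fun s => L (M s ω)) t = _
    rw [mildSolution_eq_integral_Iic L _ ht]
    refine setIntegral_congr_fun measurableSet_Ioc fun s hs => ?_
    by_cases hst : s ∈ Iic t
    · rw [indicator_of_mem hst, indicator_of_mem hst, min_eq_left hs.2]
      rfl
    · rw [indicator_of_notMem hst, indicator_of_notMem hst]
  -- Taking the horizon equal to `t` involves `M` only up to time `t`.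
  have hVad {t : ℝ} (ht : t ∈ Icc 0 T) : StronglyMeasurable[F t.toNNReal] (V t) := by
    have h := stronglyMeasurable_integral_Iic_clm_apply (m := F t.toNNReal) (T := t) (hMm t ht) hk
    have h2 := h.comp_measurable (@measurable_prodMk_left _ _ (borel ℝ) (F t.toNNReal) t)
    convert h2 using 1
    ext1 ω
    exact hVeq ⟨ht.1, le_rfl⟩ ω
  have hMad {t : ℝ} (ht : t ∈ Icc 0 T) : StronglyMeasurable[F t.toNNReal] (M t) := by
    have h2 := (hMm t ht).comp_measurable (@measurable_prodMk_left _ _ (borel ℝ) (F t.toNNReal) t)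
    simpa [Function.comp_def] using h2
  have hVae : AEStronglyMeasurable (Function.uncurry V) (ν.prod P) := by
    refine ⟨_, stronglyMeasurable_integral_Iic_clm_apply (T := T) hMT hk, ?_⟩
    filter_upwards [hicc] with p hp
    exact hVeq hp p.2
  have hVL : MemLp (Function.uncurry V) 2 (ν.prod P) := by
    obtain ⟨B, hB⟩ := (isCompact_Icc (a := 0) (b := T)).exists_bound_of_continuousOn hk.continuousOn
    have hD : MemLp (fun ω => ∫ s, ‖M s ω‖ ∂ν) 2 P :=
      MemLp.integral_prod_left (X := fun s ω => ‖M s ω‖) hML.norm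
    refine (hD.comp_snd ν).of_le_mul (c := B) hVae ?_
    filter_upwards [hicc, Measure.quasiMeasurePreserving_snd.ae hML.ae_prod_memLp_left]
      with p hp hp2
    have hi : Integrable (fun s => ‖M s p.2‖) ν := (hp2.integrable (by norm_num)).norm
    have hB0 : 0 ≤ B := (norm_nonneg _).trans (hB 0 ⟨le_rfl, hT⟩)
    have h1 : ‖V p.1 p.2‖ ≤ ∫ s in Ioc 0 p.1, B * ‖M s p.2‖ := by
      simp only [hV_def]
      rw [mildSolution, intervalIntegral.integral_of_le hp.1]
      refine norm_integral_le_of_norm_le ?_ ?_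
      · exact (hi.mono_measure (Measure.restrict_mono
          (Ioc_subset_Icc_self.trans (Icc_subset_Icc_right hp.2)) le_rfl)).const_mul B
      · filter_upwards [ae_restrict_mem measurableSet_Ioc] with s hs
        refine (ContinuousLinearMap.le_opNorm (k (p.1 - s)) _).trans ?_
        exact mul_le_mul_of_nonneg_right (hB _ ⟨by linarith [hs.2], by linarith [hs.1, hp.2]⟩)
          (norm_nonneg _)
    rw [integral_const_mul] at h1
    refine h1.trans (mul_le_mul_of_nonneg_left ?_ hB0)
    refine (setIntegral_mono_set hi (ae_of_all _ fun s => norm_nonneg _)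
      (Ioc_subset_Icc_self.trans (Icc_subset_Icc_right hp.2)).eventuallyLE).trans (le_abs_self _)
  refine ⟨fun t ω => M t ω + V t ω, ⟨fun t ht => (hMad ht).add (hVad ht), hML.add hVL⟩,
    fun t ht => (hM t ht).congr ?_⟩
  filter_upwards [hML.ae_prod_memLp_left] with ω hω
  have hMi : IntervalIntegrable (fun s => L (M s ω)) volume 0 T :=
    (intervalIntegrable_iff_integrableOn_Icc_of_le hT).2
      (L.integrable_comp (hω.integrable (by norm_num)))
  have hMi' : IntervalIntegrable (fun s => L (M s ω)) volume 0 t := hMi.mono_set (by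
    rw [uIcc_of_le hT, uIcc_of_le ht.1]; exact Icc_subset_Icc_right ht.2)
  have e := mildSolution_eq_integral L ht.1 hMi'
  simp only [map_add, hV_def]
  simp_rw [add_comm (L (M _ ω))]
  rw [← e]
  abel

end

/-! ### Quadratic forms and the closed loop -/

theorem quadForm_eq_inner {d : ℕ} (S : Matrix (Fin d) (Fin d) ℝ) (y : EuclideanSpace ℝ (Fin d)) :
    quadForm S y = inner ℝ y (Matrix.toEuclideanCLM (𝕜 := ℝ) S y) :=
  (Matrix.inner_toEuclideanCLM S y y).symm

theorem quadForm_le {d : ℕ} (S : Matrix (Fin d) (Fin d) ℝ) (y : EuclideanSpace ℝ (Fin d)) :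
    quadForm S y ≤ specNorm S * ‖y‖ ^ 2 := by
  rw [quadForm_eq_inner]
  calc inner ℝ y (Matrix.toEuclideanCLM (𝕜 := ℝ) S y)
      ≤ ‖y‖ * ‖Matrix.toEuclideanCLM (𝕜 := ℝ) S y‖ := real_inner_le_norm _ _
    _ ≤ ‖y‖ * (specNorm S * ‖y‖) :=
        mul_le_mul_of_nonneg_left (ContinuousLinearMap.le_opNorm _ _) (norm_nonneg _)
    _ = specNorm S * ‖y‖ ^ 2 := by ring

theorem quadForm_nonneg {d : ℕ} {S : Matrix (Fin d) (Fin d) ℝ} (hS : S.PosSemidef)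
    (y : EuclideanSpace ℝ (Fin d)) : 0 ≤ quadForm S y := by
  simpa [quadForm] using hS.dotProduct_mulVec_nonneg y.ofLp

theorem ae_norm_le_supNorm {d : ℕ} {T : ℝ} {σ : ℝ → EuclideanSpace ℝ (Fin d)}
    (hσ : MemLp σ ∞ (volume.restrict (Icc 0 T))) :
    ∀ᵐ s ∂volume.restrict (Icc 0 T), ‖σ s‖ ≤ supNorm T σ := by
  have hfin := hσ.2.ne
  rw [eLpNorm_exponent_top] at hfin
  filter_upwards [ae_le_eLpNormEssSup (f := σ) (μ := volume.restrict (Icc 0 T))] with s hs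
  rw [supNorm, eLpNorm_exponent_top, ← toReal_enorm]
  exact ENNReal.toReal_mono hfin hs

section

variable {Ω : Type*} {mΩ : MeasurableSpace Ω} {P : Measure Ω} [IsProbabilityMeasure P]
  {F : Filtration ℝ≥0 mΩ} {W : ℝ≥0 → Ω → ℝ} {d m : ℕ} {T h : ℝ}
  {A : Matrix (Fin d) (Fin d) ℝ} {B : Matrix (Fin d) (Fin m) ℝ}
  {σ : ℝ → EuclideanSpace ℝ (Fin d)} {K : Matrix (Fin m) (Fin d) ℝ}

theorem closedLoop_drift_eq {C : Matrix (Fin d) (Fin m) ℝ} {y : EuclideanSpace ℝ (Fin d)}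
    {u : EuclideanSpace ℝ (Fin m)} (hu : u.ofLp = -(K *ᵥ y.ofLp)) :
    (WithLp.toLp 2 (A *ᵥ y.ofLp + C *ᵥ u.ofLp) : EuclideanSpace ℝ (Fin d))
      = Matrix.toEuclideanCLM (𝕜 := ℝ) (A - C * K) y := by
  rw [hu]
  ext i
  rw [Matrix.ofLp_toEuclideanCLM, Matrix.sub_mulVec, Matrix.mulVec_neg, Matrix.mulVec_mulVec,
    sub_eq_add_neg]

theorem IsFeedbackPair.integral_norm_sq_eq (hW : IsPreBrownianReal W P)
    (hσ : MemLp σ 2 (volume.restrict (Icc 0 T)))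
    {U : ℝ → Ω → EuclideanSpace ℝ (Fin m)} {Y : ℝ → Ω → EuclideanSpace ℝ (Fin d)}
    (hUY : IsFeedbackPair P F W T h A B σ K U Y) {t : ℝ} (ht : t ∈ Icc 0 T) :
    MemLp (Y t) 2 P ∧ ∫ ω, ‖Y t ω‖ ^ 2 ∂P = ∫ s in (0 : ℝ)..t, ‖NormedSpace.exp
      ((t - s) • Matrix.toEuclideanCLM (𝕜 := ℝ) (A - artsteinInput A B h * K)) (σ s)‖ ^ 2 := by
  -- The noise term `N` is here `Y` minus its drift integral, so the equation holds for every `ω`.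
  refine integral_norm_sq_eq_of_linear_sde hW hσ _ hUY.state.mem.memLp hUY.state.eqn
    (fun t ht => ae_of_all _ fun ω => ?_) ht
  have : ∫ s in (0 : ℝ)..t, Matrix.toEuclideanCLM (𝕜 := ℝ) (A - artsteinInput A B h * K) (Y s ω)
      = ∫ s in (0 : ℝ)..t, (WithLp.toLp 2 (A *ᵥ (Y s ω).ofLp
          + artsteinInput A B h *ᵥ (U s ω).ofLp) : EuclideanSpace ℝ (Fin d)) := by
    refine intervalIntegral.integral_congr fun s hs => ?_
    rw [uIcc_of_le ht.1] at hs
    exact (closedLoop_drift_eq (hUY.feedback s ⟨hs.1, hs.2.trans ht.2⟩ ω)).symm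
  rw [this, sub_add_cancel]

/-- The exact value is `C² / (2c) * (1 - e^{-2ct})`; dropping the nonpositive term makes the bound
independent of `t`. -/
theorem integral_exp_neg_sq_le {c t C : ℝ} (hc : 0 < c) :
    ∫ s in (0 : ℝ)..t, (Real.exp (-c * (t - s)) * C) ^ 2 ≤ C ^ 2 / (2 * c) := by
  have hd (s : ℝ) : HasDerivAt (fun s => C ^ 2 / (2 * c) * Real.exp (2 * (-c * (t - s))))
      ((Real.exp (-c * (t - s)) * C) ^ 2) s := by
    have h1 : HasDerivAt (fun s => 2 * (-c * (t - s))) (2 * c) s := by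
      have := (((hasDerivAt_id s).const_sub t).const_mul (-c)).const_mul 2
      simpa using this
    refine (h1.exp.const_mul (C ^ 2 / (2 * c))).congr_deriv ?_
    rw [mul_pow, ← Real.exp_nat_mul]
    push_cast
    field_simp
  rw [intervalIntegral.integral_eq_sub_of_hasDerivAt (fun s _ => hd s)
    ((by fun_prop : Continuous fun s => (Real.exp (-c * (t - s)) * C) ^ 2).intervalIntegrable _ _)]
  have : 0 ≤ C ^ 2 / (2 * c) * Real.exp (2 * (-c * (t - 0))) := by positivity
  simp only [sub_self, mul_zero, Real.exp_zero, mul_one] at this ⊢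
  linarith

theorem IsFeedbackPair.integral_norm_sq_le (hW : IsPreBrownianReal W P)
    (hσ : MemLp σ ∞ (volume.restrict (Icc 0 T))) {c : ℝ} (hc : 0 < c)
    (hK : IsNormalWithAbscissaLE (A - artsteinInput A B h * K) (-c))
    {U : ℝ → Ω → EuclideanSpace ℝ (Fin m)} {Y : ℝ → Ω → EuclideanSpace ℝ (Fin d)}
    (hUY : IsFeedbackPair P F W T h A B σ K U Y) {t : ℝ} (ht : t ∈ Icc 0 T) :
    ∫ ω, ‖Y t ω‖ ^ 2 ∂P ≤ supNorm T σ ^ 2 / (2 * c) := by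
  rw [(hUY.integral_norm_sq_eq hW (hσ.mono_exponent le_top) ht).2]
  refine le_trans ?_ (integral_exp_neg_sq_le (t := t) hc)
  rw [intervalIntegral.integral_of_le ht.1, intervalIntegral.integral_of_le ht.1]
  refine integral_mono_of_nonneg (ae_of_all _ fun s => by positivity) ?_ ?_
  · exact ((by fun_prop : Continuous fun s =>
      (Real.exp (-c * (t - s)) * supNorm T σ) ^ 2).integrableOn_Icc).mono_set Ioc_subset_Icc_self
  · have hsub : Ioc 0 t ⊆ Icc 0 T := Ioc_subset_Icc_self.trans (Icc_subset_Icc_right ht.2)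
    filter_upwards [ae_restrict_of_ae_restrict_of_subset hsub (ae_norm_le_supNorm hσ),
      ae_restrict_mem measurableSet_Ioc] with s hs hst
    refine pow_le_pow_left₀ (norm_nonneg _) ?_ 2
    exact (ContinuousLinearMap.le_opNorm _ _).trans (mul_le_mul
      (norm_exp_smul_toEuclideanCLM_le hK (sub_nonneg.2 hst.2)) hs (norm_nonneg _)
      (Real.exp_pos _).le)

theorem IsFeedbackPair.integral_quadForm_le (hW : IsPreBrownianReal W P)
    (hσ : MemLp σ ∞ (volume.restrict (Icc 0 T))) {c : ℝ} (hc : 0 < c)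
    (hK : IsNormalWithAbscissaLE (A - artsteinInput A B h * K) (-c))
    {U : ℝ → Ω → EuclideanSpace ℝ (Fin m)} {Y : ℝ → Ω → EuclideanSpace ℝ (Fin d)}
    (hUY : IsFeedbackPair P F W T h A B σ K U Y) (S : Matrix (Fin d) (Fin d) ℝ) {t : ℝ}
    (ht : t ∈ Icc 0 T) :
    Integrable (fun ω => quadForm S (Y t ω)) P ∧
      ∫ ω, quadForm S (Y t ω) ∂P ≤ specNorm S * supNorm T σ ^ 2 / (2 * c) := by
  have hY := (hUY.integral_norm_sq_eq hW (hσ.mono_exponent le_top) ht).1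
  have hi : Integrable (fun ω => quadForm S (Y t ω)) P := by
    simp_rw [quadForm_eq_inner]
    exact hY.integrable_inner ((Matrix.toEuclideanCLM (𝕜 := ℝ) S).comp_memLp' hY)
  refine ⟨hi, ?_⟩
  calc ∫ ω, quadForm S (Y t ω) ∂P ≤ ∫ ω, specNorm S * ‖Y t ω‖ ^ 2 ∂P :=
        integral_mono hi ((hY.integrable_norm_pow (by norm_num)).const_mul _)
          fun ω => quadForm_le S (Y t ω)
    _ ≤ specNorm S * (supNorm T σ ^ 2 / (2 * c)) := by
        rw [integral_const_mul]
        exact mul_le_mul_of_nonneg_left (hUY.integral_norm_sq_le hW hσ hc hK ht) (norm_nonneg _)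
    _ = specNorm S * supNorm T σ ^ 2 / (2 * c) := by ring

/-- The closed-loop equation is solved first; the control is then defined as `-K Y` and inherits
adaptedness and square integrability. -/
theorem exists_isFeedbackPair (hW : IsPreBrownianReal W P) (hWF : StronglyAdapted F W)
    (hT : 0 ≤ T) (hσ : MemLp σ ∞ (volume.restrict (Icc 0 T))) :
    ∃ U Y, IsFeedbackPair P F W T h A B σ K U Y := by
  obtain ⟨Y, hY, hYe⟩ := exists_linear_sde hW hWF hT (hσ.mono_exponent le_top)
    (ae_norm_le_supNorm hσ) (Matrix.toEuclideanCLM (𝕜 := ℝ) (A - artsteinInput A B h * K))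
  set G : EuclideanSpace ℝ (Fin d) →L[ℝ] EuclideanSpace ℝ (Fin m) :=
    -(Matrix.toEuclideanLin K).toContinuousLinearMap
  have hG (y : EuclideanSpace ℝ (Fin d)) : (G y).ofLp = -(K *ᵥ y.ofLp) := rfl
  refine ⟨fun t ω => G (Y t ω), Y, ⟨fun t ht => ?_, G.comp_memLp' hY.memLp⟩, ⟨hY, fun t ht => ?_⟩,
    fun t _ ω => hG _⟩
  · exact G.continuous.comp_stronglyMeasurable (hY.adapted t ht)
  · simp_rw [closedLoop_drift_eq (hG _)]
    exact hYe t ht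

end

end

theorem mainTheorem7 {Ω : Type*} {mΩ : MeasurableSpace Ω} (P : Measure Ω) [IsProbabilityMeasure P]
    (F : Filtration ℝ≥0 mΩ) (W : ℝ≥0 → Ω → ℝ) (hW : IsBrownianReal W P)
    (hWF : StronglyAdapted F W) {d m : ℕ} (T h : ℝ) (hh : 0 < h) (hhT : h < T)
    (A : Matrix (Fin d) (Fin d) ℝ) (B : Matrix (Fin d) (Fin m) ℝ)
    (σ : ℝ → EuclideanSpace ℝ (Fin d)) (hσ : MemLp σ ∞ (volume.restrict (Icc 0 T)))
    (K : ℕ → Matrix (Fin m) (Fin d) ℝ)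
    (hK : ∀ n : ℕ, 1 ≤ n →
      IsNormalWithAbscissaLE (A - artsteinInput A B h * K n) (-(n : ℝ))) :
    (∀ n : ℕ, 1 ≤ n → ∃ U Y, IsFeedbackPair P F W T h A B σ (K n) U Y) ∧
    (∀ n : ℕ, 1 ≤ n → ∀ U Y, IsFeedbackPair P F W T h A B σ (K n) U Y →
      ∀ S : Matrix (Fin d) (Fin d) ℝ, S.PosSemidef → ∀ t ∈ Icc 0 T,
        Integrable (fun ω => quadForm S (Y t ω)) P ∧
        ∫ ω, quadForm S (Y t ω) ∂P ≤ specNorm S * supNorm T σ ^ 2 / (2 * n)) ∧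
    (∀ (U : ℕ → ℝ → Ω → EuclideanSpace ℝ (Fin m)) (Y : ℕ → ℝ → Ω → EuclideanSpace ℝ (Fin d)),
      (∀ n : ℕ, 1 ≤ n → IsFeedbackPair P F W T h A B σ (K n) (U n) (Y n)) →
      ∀ S : Matrix (Fin d) (Fin d) ℝ, S.PosSemidef → ∀ t ∈ Icc 0 (T - h),
        Tendsto (fun n => ∫ ω, quadForm S (Y n t ω) ∂P) atTop (𝓝 0)) := by
  refine ⟨fun n _ => exists_isFeedbackPair hW.toIsPreBrownianReal hWF (hh.trans hhT).le hσ,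
    fun n hn U Y hUY S _ t ht => ?_, fun U Y hUY S hS t ht => ?_⟩
  · exact hUY.integral_quadForm_le hW.toIsPreBrownianReal hσ (by positivity) (hK n hn) S ht
  · have ht' : t ∈ Icc 0 T := ⟨ht.1, by linarith [ht.2]⟩
    -- Squeeze between zero, by semidefiniteness, and the bound of order `1 / n`, which is claimed
    -- only from `n = 1` on.
    refine tendsto_of_tendsto_of_tendsto_of_le_of_le' tendsto_const_nhds
      (h := fun n : ℕ => specNorm S * supNorm T σ ^ 2 / (2 * n)) ?_ ?_ ?_
    · exact tendsto_const_nhds.div_atTop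
        (tendsto_natCast_atTop_atTop.const_mul_atTop (by norm_num))
    · exact Eventually.of_forall fun n => integral_nonneg fun ω => quadForm_nonneg hS _
    · filter_upwards [eventually_ge_atTop 1] with n hn
      exact ((hUY n hn).integral_quadForm_le hW.toIsPreBrownianReal hσ
        (by positivity) (hK n hn) S ht').2
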